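/- Let $0\le p<n$ be integers and let $(e_1,\dots,e_n)$ be the standard basis of $\mathbb{C}^n$. For $1\le k\le n$ let $r^{(k)}\in U(n)$ be independent random reflections (i.e. $r^{(k)}-\mathrm{Id}$ has rank at most $1$) such that $r^{(k)}e_j=e_j$ for $j<k$ and $r^{(k)}e_k$ is uniformly distributed on the unit sphere $\{(0,\dots,0,x_k,\dots,x_n):|x_k|^2+\dots+|x_n|^2=1\}$. The Haar measure on $U(n)$ conditioned to have $p$ eigenvalues equal to $1$ is, by definition, the law of the product $r^{(1)}\cdots r^{(n-p)}$ (for $p=0$ this is the Haar measure on $U(n)$). Let $u$ have this law and let $$Z_U^{(p)}=\frac{d^p}{dx^p}\Big|_{x=1}\det(x\,\mathrm{Id}-u)$$ be the $p$-th derivative at $1$ of its characteristic polynomial. Then there is a constant $d>0$, depending only on $n$ and $p$, such that the law of $|Z_U^{(p)}|$ has a density $h_n^{(U)}$ with respect to Lebesgue measure (that is, a version of the density) satisfying $$h_n^{(U)}(\varepsilon)\sim d\,\varepsilon^{2p}\qquad(\varepsilon\to0^+).$$ -/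

import Mathlib

open MeasureTheory

/-- The unit sphere of the complex space spanned by the basis vectors `e_j`, `j ≥ k`, of `ℂⁿ`
(indices run from `0` to `n - 1`). -/
abbrev TailSphere (n : ℕ) (k : Fin n) : Type :=
  Metric.sphere (0 : EuclideanSpace ℂ {j : Fin n // k ≤ j}) 1

/-- The uniform probability measure on that sphere: normalized surface measure. -/
noncomputable def uniformTailSphere (n : ℕ) (k : Fin n) : Measure (TailSphere n k) :=
  ((volume : Measure (EuclideanSpace ℂ {j : Fin n // k ≤ j})).toSphere Set.univ)⁻¹ •
    (volume : Measure (EuclideanSpace ℂ {j : Fin n // k ≤ j})).toSphere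

/-- A point of the sphere as a vector `(0, …, 0, x_k, …, x_{n-1})` of `ℂⁿ`. -/
def tailVector {n : ℕ} {k : Fin n} (x : TailSphere n k) : Fin n → ℂ :=
  fun j => if h : k ≤ j then x.1 ⟨j, h⟩ else 0

/-- For a unit vector `v` with vanishing coordinates before `k`, the unitary reflection
(`r - 1` has rank at most one) that fixes `e_j` for `j < k` and sends `e_k` to `v`: its `j`-th
column is `e_j - (v - e_k) * conj (v_j) / (1 - conj (v_k))` for `j ≠ k`, and `v` for `j = k`.
For `v = e_k` (where the denominator vanishes) it is the identity. -/
noncomputable def reflectionMatrix {n : ℕ} (k : Fin n) (v : Fin n → ℂ) :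
    Matrix (Fin n) (Fin n) ℂ :=
  1 - (1 / (1 - star (v k))) • Matrix.vecMulVec (v - Pi.single k 1) (star (v - Pi.single k 1))

theorem star_tailVector_dotProduct {n : ℕ} {k : Fin n} (x : TailSphere n k) :
    star (tailVector x) ⬝ᵥ tailVector x = 1 := by
  have hx : ‖x.1‖ = 1 := by simp
  have h2 : ∑ i, ‖x.1 i‖ ^ 2 = 1 := by
    rw [← EuclideanSpace.norm_sq_eq, hx, one_pow]
  have h3 : star (tailVector x) ⬝ᵥ tailVector x = ∑ i, ((‖x.1 i‖ ^ 2 : ℝ) : ℂ) := by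
    classical
    rw [dotProduct, ← Finset.sum_subset (Finset.filter_subset (fun j => k ≤ j) Finset.univ)]
    · rw [Finset.sum_subtype (p := fun j => k ≤ j) _ (by simp)]
      refine Finset.sum_congr rfl fun i _ => ?_
      have hi := i.2
      simp [tailVector, hi, Complex.conj_mul']
    · intro j _ hj
      have : ¬ k ≤ j := by simpa using hj
      simp [tailVector, this]
  rw [h3, ← Complex.ofReal_sum, h2, Complex.ofReal_one]

theorem reflectionMatrix_mem_unitaryGroup {n : ℕ} (k : Fin n) (v : Fin n → ℂ)
    (hv : star v ⬝ᵥ v = 1) : reflectionMatrix k v ∈ Matrix.unitaryGroup (Fin n) ℂ := by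
  by_cases h : 1 - star (v k) = 0
  · rw [reflectionMatrix, h]
    simp
  · have h' : 1 - v k ≠ 0 := fun h0 => h (by
      have := congrArg star h0
      simpa using this)
    rw [Matrix.mem_unitaryGroup_iff, reflectionMatrix]
    set w := v - Pi.single k 1 with hw
    have hww : star w ⬝ᵥ w = (1 - v k) + (1 - star (v k)) := by
      simp [hw, sub_dotProduct, dotProduct_sub, hv]
      ring
    have hs : star (Matrix.vecMulVec w (star w)) = Matrix.vecMulVec w (star w) := by
      rw [Matrix.star_eq_conjTranspose, Matrix.conjTranspose_vecMulVec, star_star]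
    have hm : Matrix.vecMulVec w (star w) * Matrix.vecMulVec w (star w) =
        ((1 - v k) + (1 - star (v k))) • Matrix.vecMulVec w (star w) := by
      rw [Matrix.vecMulVec_mul_vecMulVec, hww]
      ext i j
      simp [Matrix.vecMulVec_apply]
      ring
    have hc : star (1 / (1 - star (v k))) = 1 / (1 - v k) := by simp
    rw [star_sub (1 : Matrix (Fin n) (Fin n) ℂ), star_one, star_smul, hs, hc, sub_mul, one_mul, mul_sub, mul_one, smul_mul_smul_comm, hm, smul_smul]
    have : (1 / (1 - star (v k)) * (1 / (1 - v k)) * ((1 - v k) + (1 - star (v k)))) =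
        1 / (1 - star (v k)) + 1 / (1 - v k) := by
      field_simp
    rw [this, add_smul]
    abel

/-- The unitary group `U(n)` carries its Borel sigma-algebra. -/
noncomputable instance unitaryGroupMeasurableSpace (n : ℕ) :
    MeasurableSpace (Matrix.unitaryGroup (Fin n) ℂ) := borel _

instance unitaryGroupBorelSpace (n : ℕ) :
    BorelSpace (Matrix.unitaryGroup (Fin n) ℂ) := ⟨rfl⟩

/-- The reflection in `U(n)` attached to a point of the sphere. -/
noncomputable def reflection {n : ℕ} (k : Fin n) (x : TailSphere n k) :
    Matrix.unitaryGroup (Fin n) ℂ :=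
  ⟨reflectionMatrix k (tailVector x),
    reflectionMatrix_mem_unitaryGroup k _ (star_tailVector_dotProduct x)⟩

/-- The law of the random reflection fixing `e_j` for `j < k` and whose `k`-th column is uniform
on the unit sphere of the span of `e_k, …, e_{n-1}`. -/
noncomputable def reflectionLaw (n : ℕ) (k : Fin n) :
    Measure (Matrix.unitaryGroup (Fin n) ℂ) :=
  (uniformTailSphere n k).map (reflection k)

/-- The Haar measure on `U(n)` conditioned to have `p` eigenvalues equal to `1`: the law of the
ordered product of the first `n - p` of the independent random reflections. -/
noncomputable def conditionalHaar (n p : ℕ) : Measure (Matrix.unitaryGroup (Fin n) ℂ) :=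
  (Measure.pi fun k : Fin (n - p) => reflectionLaw n (k.castLE (Nat.sub_le n p))).map
    fun r => (List.ofFn r).prod

/-- The `p`-th derivative at `1` of the characteristic polynomial `det (X - u)`. -/
noncomputable def charpolyDeriv {n : ℕ} (p : ℕ) (u : Matrix.unitaryGroup (Fin n) ℂ) : ℂ :=
  (Polynomial.derivative^[p] (u : Matrix (Fin n) (Fin n) ℂ).charpoly).eval 1

/-!
A product of complex reflections `1 - c_i • w_i w_i*` equals `1 - W A W*`, where the columns of `W`
are the roots `w_i` and `A` is upper triangular with diagonal `c_i`. Exchanging the factors in the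
characteristic polynomial therefore shows that its `p`-th derivative at `1`, for `n - p` factors in
dimension `n`, is `p! * (∏ c_i) * det (W* W)` (`norm_charpolyDeriv_prod_reflection`). Here
`w_i = v_i - e_i` with `v_i` uniform on the sphere of the span of `e_i, e_{i+1}, …`.

Removing the first root from the Gram determinant leaves the squared distance from it to the span of
the later ones. Given the later roots, this distance is the length of the projection of the first
root to a space of dimension `p + 1` containing `e_i`, so by unitary invariance its law does not
depend on them (`exists_rootStatistic_eq_mul`). The modulus of the derivative is thus, in law, a
product of independent factors `‖y‖ ^ 2 / ‖y 0‖` with `y = e_0 - z`, where `z` consists of `p + 1`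
coordinates of a uniform point of a sphere.

* For the last reflection there is no coordinate besides these, and polar coordinates centred at `1`
  show that the factor is `2 * cos φ` with `φ` of density proportional to `(cos φ) ^ (2 * p)`; hence
  it has a density equivalent to a multiple of `ε ^ (2 * p)` (`hasPowerDensity_map_ratio`).
* For the earlier reflections `z` has a bounded density on the unit ball. As `‖y‖ ^ 2 / ‖y 0‖` is
  homogeneous of degree one on a space of real dimension `2 * p + 2`, the law of the factor is at
  most a multiple of `t ^ (2 * p + 1)` (`exists_factorLaw_le_powerMeasure`).

A factor of the second kind `Y` has a finite moment of order `-(2 * p + 1)`. Multiplication by it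
preserves the behaviour `d * ε ^ (2 * p)` of a density at `0` and multiplies `d` by this moment
(`HasPowerDensity.map_mul_prod`).
-/

/-! ### The characteristic polynomial of a product of reflections -/

/-- The root of the reflection attached to `x`: its column `k` minus `e_k`. -/
noncomputable def reflectionRoot {n : ℕ} {k : Fin n} (x : TailSphere n k) : Fin n → ℂ :=
  tailVector x - Pi.single k 1

/-- The product of the absolute values of the coefficients of the reflections and of the Gram
determinant of their roots. If `x i` is a basis vector its root is zero and the coefficient is the
junk value `1 / 0 = 0`, in agreement with the reflection being the identity. -/
noncomputable def rootStatistic {l n : ℕ} (k : Fin l → Fin n) (x : ∀ i, TailSphere n (k i)) : ℝ :=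
  (∏ i, ‖1 / (1 - star (tailVector (x i) (k i)))‖) *
    ‖(Matrix.of fun i j => star (reflectionRoot (x i)) ⬝ᵥ reflectionRoot (x j)).det‖

/-- The matrix `A` is upper triangular with diagonal `c`, but only its determinant matters. -/
theorem exists_prod_one_sub_smul_vecMulVec {R : Type*} [CommRing R] {n m : ℕ} (c : Fin m → R)
    (v w : Fin m → Fin n → R) :
    ∃ A : Matrix (Fin m) (Fin m) R, A.det = ∏ i, c i ∧
      (List.ofFn fun i => 1 - c i • Matrix.vecMulVec (v i) (w i)).prod =
        1 - (Matrix.of v).transpose * A * Matrix.of w := by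
  -- The double sum is easier to split off a first index than the matrix product.
  suffices H : ∃ A : Matrix (Fin m) (Fin m) R, A.det = ∏ i, c i ∧
      (List.ofFn fun i => 1 - c i • Matrix.vecMulVec (v i) (w i)).prod =
        1 - ∑ i, ∑ j, A i j • Matrix.vecMulVec (v i) (w j) by
    obtain ⟨A, hA, h⟩ := H
    refine ⟨A, hA, h.trans ?_⟩
    congr 1
    ext a b
    simp only [Matrix.sum_apply, Matrix.smul_apply, Matrix.vecMulVec_apply, Matrix.mul_apply,
      Matrix.transpose_apply, Matrix.of_apply, smul_eq_mul, Finset.sum_mul]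
    rw [Finset.sum_comm]
    exact Finset.sum_congr rfl fun i _ => Finset.sum_congr rfl fun j _ => by ring
  induction m with
  | zero => exact ⟨1, by simp, by simp⟩
  | succ m ih =>
    obtain ⟨A, hA, h⟩ := ih (fun i => c i.succ) (fun i => v i.succ) (fun i => w i.succ)
    refine ⟨Matrix.of (Fin.cons (Fin.cons (c 0)
      (fun j => -(c 0 * ∑ i, (w 0 ⬝ᵥ v i.succ) * A i j))) (fun i => Fin.cons 0 (A i))), ?_, ?_⟩
    · rw [Matrix.det_succ_column_zero, Fin.sum_univ_succ, Fin.prod_univ_succ, ← hA]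
      simp [Matrix.submatrix]
      rfl
    · rw [List.ofFn_succ, List.prod_cons, h]
      simp only [Fin.sum_univ_succ, Matrix.of_apply, Fin.cons_zero, Fin.cons_succ, zero_smul,
        zero_add]
      have key : Matrix.vecMulVec (v 0) (w 0) *
          ∑ i, ∑ j, A i j • Matrix.vecMulVec (v i.succ) (w j.succ) =
          ∑ j, (∑ i, (w 0 ⬝ᵥ v i.succ) * A i j) • Matrix.vecMulVec (v 0) (w j.succ) := by
        rw [Finset.sum_comm, Finset.mul_sum]
        refine Finset.sum_congr rfl fun j _ => ?_
        rw [Finset.mul_sum, Finset.sum_smul]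
        refine Finset.sum_congr rfl fun i _ => ?_
        rw [mul_smul_comm, Matrix.vecMulVec_mul_vecMulVec]
        ext a b
        simp [Matrix.vecMulVec_apply]
        ring
      rw [sub_mul, one_mul, mul_sub, mul_one, smul_mul_assoc, key]
      simp only [neg_smul, Finset.sum_neg_distrib, mul_smul, ← Finset.smul_sum]
      abel

/-- The `p`-th derivative at `1` of a characteristic polynomial that vanishes there to order `p`:
both sides are read off from the lowest coefficient after the shift by `1`. -/
theorem eval_iterate_derivative_charpoly_one_sub {R : Type*} [CommRing R] {n m p : ℕ}
    (h : m + p = n) (U : Matrix (Fin n) (Fin m) R) (A : Matrix (Fin m) (Fin m) R)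
    (V : Matrix (Fin m) (Fin n) R) :
    (Polynomial.derivative^[p] (1 - U * A * V).charpoly).eval 1 =
      p.factorial * (A.det * (V * U).det) := by
  rw [← Polynomial.factorial_smul_hasseDeriv, LinearMap.smul_apply, nsmul_eq_mul,
    Polynomial.eval_mul, Polynomial.eval_natCast, ← Polynomial.taylor_coeff, Polynomial.taylor_apply, ← Matrix.charpoly_sub_scalar]
  have h1 : 1 - U * A * V - Matrix.scalar (Fin n) (1 : R) = (-(U * A)) * V := by
    simp
  rw [h1, Matrix.charpoly_mul_comm_of_le _ _ (by simp; omega)]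
  have h2 : Fintype.card (Fin n) - Fintype.card (Fin m) = p := by simp; omega
  rw [h2, Polynomial.coeff_X_pow_mul', if_pos le_rfl, Nat.sub_self,
    Polynomial.coeff_zero_eq_eval_zero, Matrix.eval_charpoly]
  have h3 : Matrix.scalar (Fin m) (0 : R) - V * -(U * A) = V * U * A := by
    simp [Matrix.mul_assoc]
  rw [h3, Matrix.det_mul, mul_comm A.det]

theorem norm_charpolyDeriv_prod_reflection {n m p : ℕ} (h : m + p = n) (k : Fin m → Fin n)
    (x : ∀ i, TailSphere n (k i)) :
    ‖charpolyDeriv p (List.ofFn fun i => reflection (k i) (x i)).prod‖ =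
      p.factorial * rootStatistic k x := by
  obtain ⟨A, hA, hprod⟩ := exists_prod_one_sub_smul_vecMulVec
    (fun i => 1 / (1 - star (tailVector (x i) (k i)))) (fun i => reflectionRoot (x i))
    (fun i => star (reflectionRoot (x i)))
  have hcoe : (((List.ofFn fun i => reflection (k i) (x i)).prod :
      Matrix.unitaryGroup (Fin n) ℂ) : Matrix (Fin n) (Fin n) ℂ) =
      (List.ofFn fun i => reflectionMatrix (k i) (tailVector (x i))).prod := by
    rw [← Submonoid.coe_subtype, map_list_prod, List.map_ofFn]
    rfl
  rw [charpolyDeriv, hcoe]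
  change ‖(Polynomial.derivative^[p] (List.ofFn fun i => 1 -
    (1 / (1 - star (tailVector (x i) (k i)))) • Matrix.vecMulVec (reflectionRoot (x i))
      (star (reflectionRoot (x i)))).prod.charpoly).eval 1‖ = _
  rw [hprod, eval_iterate_derivative_charpoly_one_sub h, hA, norm_mul, norm_mul, norm_prod,
    rootStatistic, Complex.norm_natCast]
  congr 3

/-! ### Splitting off one vector from a Gram determinant -/

section Gram

variable {E : Type*} [NormedAddCommGroup E] [InnerProductSpace ℂ E]

/-- Subtracting from the first row the combination of the other rows that corresponds to the
projection of `w₀` leaves a first row with a single nonzero entry. -/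
theorem det_gram_cons_of_inner_eq_zero {l : ℕ} (w₀ : E) (w : Fin l → E) (a : Fin l → ℂ)
    (h : ∀ j, inner ℂ (w₀ - ∑ i, a i • w i) (w j) = 0) :
    (Matrix.gram ℂ (Fin.cons w₀ w : Fin (l + 1) → E)).det =
      (‖w₀ - ∑ i, a i • w i‖ ^ 2 : ℝ) * (Matrix.gram ℂ w).det := by
  set u := w₀ - ∑ i, a i • w i with hu
  set v : Fin (l + 1) → E := Fin.cons w₀ w with hv
  have hrow : ∀ j, (∑ k, (Fin.cons 1 (fun i => -star (a i)) : Fin (l + 1) → ℂ) k •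
      (Matrix.gram ℂ v) k) j = inner ℂ u (v j) := by
    intro j
    simp only [Finset.sum_apply, Pi.smul_apply, Matrix.gram_apply, smul_eq_mul]
    rw [Fin.sum_univ_succ, hu, inner_sub_left, sum_inner]
    simp [hv, inner_smul_left, sub_eq_add_neg]
  have huw : inner ℂ u w₀ = ((‖u‖ ^ 2 : ℝ) : ℂ) := by
    have h1 : w₀ = u + ∑ i, a i • w i := by simp [hu]
    conv_lhs => rw [h1]
    rw [inner_add_right, inner_sum]
    simp [inner_smul_right, h]
  have hdet := Matrix.det_updateRow_sum (Matrix.gram ℂ v) 0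
    (Fin.cons 1 (fun i => -star (a i)) : Fin (l + 1) → ℂ)
  rw [Fin.cons_zero, one_smul] at hdet
  rw [← hdet, Matrix.det_succ_row_zero, Fin.sum_univ_succ]
  have hz : ∀ i : Fin l, inner ℂ u (v i.succ) = 0 := fun i => by simp [hv, h]
  simp only [Matrix.updateRow_self, hrow, hz]
  have hsub : ((Matrix.gram ℂ v).updateRow 0 (∑ k,
      (Fin.cons 1 (fun i => -star (a i)) : Fin (l + 1) → ℂ) k • (Matrix.gram ℂ v) k)).submatrix
      Fin.succ ((0 : Fin (l + 1)).succAbove) = Matrix.gram ℂ w := by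
    ext i j
    simp [hv, Matrix.gram_apply, Matrix.updateRow_apply]
  rw [hsub]
  simp [hv, huw]

/-- The squared distance from `w₀` to the span of `w`, in coordinates. If the `w i` are dependent,
both Gram determinants vanish and any orthonormal family extending `e` serves. -/
theorem exists_orthonormal_det_gram_cons [FiniteDimensional ℂ E] {l p : ℕ}
    (hE : Module.finrank ℂ E = l + (p + 1)) (e : E) (he : ‖e‖ = 1) (w : Fin l → E)
    (hw : ∀ j, inner ℂ e (w j) = 0) :
    ∃ q : Fin (p + 1) → E, Orthonormal ℂ q ∧ q 0 = e ∧ ∀ w₀ : E,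
      (Matrix.gram ℂ (Fin.cons w₀ w : Fin (l + 1) → E)).det =
        (∑ i, ‖inner ℂ (q i) w₀‖ ^ 2 : ℝ) * (Matrix.gram ℂ w).det := by
  by_cases hdet : (Matrix.gram ℂ w).det = 0
  · have hs : Orthonormal ℂ (({0} : Set (Fin (l + (p + 1)))).domRestrict fun _ => e) := by
      refine ⟨fun i => by simpa using he, fun i j hij => ?_⟩
      exact absurd (Subsingleton.elim i j) hij
    obtain ⟨b, hb⟩ := Orthonormal.exists_orthonormalBasis_extension_of_card_eq
      (ι := Fin (l + (p + 1))) (by simpa using hE) hs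
    refine ⟨fun i => b ⟨i, by omega⟩, b.orthonormal.comp _ fun i j hij => ?_, ?_, fun w₀ => ?_⟩
    · exact Fin.ext (by simpa using hij)
    · exact hb _ (by simp)
    · rw [hdet, mul_zero]
      by_contra hne
      have hli := Matrix.det_gram_ne_zero_iff_linearIndependent.1 hne
      have hli' : LinearIndependent ℂ w := hli.comp Fin.succ (Fin.succ_injective _)
      exact Matrix.det_gram_ne_zero_iff_linearIndependent.2 hli' hdet
  · have hli : LinearIndependent ℂ w := Matrix.det_gram_ne_zero_iff_linearIndependent.1 hdet
    set S := Submodule.span ℂ (Set.range w) with hS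
    have hSd : Module.finrank ℂ S = l := by simpa using finrank_span_eq_card hli
    have hK : Module.finrank ℂ Sᗮ = p + 1 := by
      have := Submodule.finrank_add_finrank_orthogonal S
      omega
    have heK : e ∈ Sᗮ := by
      rw [Submodule.mem_orthogonal']
      intro u hu
      induction hu using Submodule.span_induction with
      | mem x hx => obtain ⟨j, rfl⟩ := hx; exact hw j
      | zero => simp
      | add x y _ _ hx hy => simp [inner_add_right, hx, hy]
      | smul a x _ hx => simp [inner_smul_right, hx]
    have hs : Orthonormal ℂ (({0} : Set (Fin (p + 1))).domRestrict
        fun _ => (⟨e, heK⟩ : Sᗮ)) := by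
      refine ⟨fun i => by simpa using he, fun i j hij => ?_⟩
      exact absurd (Subsingleton.elim i j) hij
    obtain ⟨b, hb⟩ := Orthonormal.exists_orthonormalBasis_extension_of_card_eq
      (ι := Fin (p + 1)) (by simpa using hK) hs
    refine ⟨fun i => (b i : E), b.orthonormal.comp_linearIsometry Sᗮ.subtypeₗᵢ, ?_, fun w₀ => ?_⟩
    · exact congrArg Subtype.val (hb 0 (by simp))
    · have hproj : S.starProjection w₀ ∈ S := Submodule.starProjection_apply_mem _ _
      obtain ⟨a, ha⟩ := (Submodule.mem_span_range_iff_exists_fun ℂ).1 hproj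
      have hu : w₀ - ∑ i, a i • w i = (Sᗮ.orthogonalProjectionOnto w₀ : E) := by
        rw [ha, ← Submodule.starProjection_apply, Submodule.starProjection_orthogonal_val]
      rw [det_gram_cons_of_inner_eq_zero w₀ w a fun j => ?_, hu]
      · congr 2
        have h1 := b.sum_sq_norm_inner_right (Sᗮ.orthogonalProjectionOnto w₀)
        rw [← Submodule.coe_norm, ← h1]
        refine Finset.sum_congr rfl fun i _ => ?_
        rw [Submodule.inner_orthogonalProjectionOnto_eq_of_mem_left]
      · rw [hu]
        have hj : w j ∈ S := Submodule.subset_span (Set.mem_range_self j)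
        exact Submodule.inner_left_of_mem_orthogonal hj (Submodule.coe_mem _)

end Gram

/-- The restriction of a vector to the coordinates from `k` on. -/
noncomputable def tailRestrict {n : ℕ} (k : Fin n) (v : Fin n → ℂ) :
    EuclideanSpace ℂ {j : Fin n // k ≤ j} :=
  WithLp.toLp 2 fun j => v j

theorem inner_tailRestrict {n : ℕ} (k : Fin n) (v w : Fin n → ℂ) (hv : ∀ j, ¬ k ≤ j → v j = 0) :
    inner ℂ (tailRestrict k v) (tailRestrict k w) = star v ⬝ᵥ w := by
  rw [PiLp.inner_apply, dotProduct,
    ← Finset.sum_subset (Finset.filter_subset (fun j => k ≤ j) Finset.univ)]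
  · rw [Finset.sum_subtype (p := fun j => k ≤ j) (F := inferInstance) _ (by simp)]
    simp [tailRestrict, mul_comm]
  · intro j _ hj
    simp [hv j (by simpa using hj)]

theorem reflectionRoot_eq_zero {n : ℕ} {k : Fin n} (x : TailSphere n k) {j : Fin n}
    (hj : ¬ k ≤ j) : reflectionRoot x j = 0 := by
  have h1 : j ≠ k := fun h => hj h.ge
  simp [reflectionRoot, tailVector, hj, h1]

theorem tailVector_self {n : ℕ} {k : Fin n} (x : TailSphere n k) :
    tailVector x k = x.1 ⟨k, le_rfl⟩ := by
  simp [tailVector]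

/-- The first basis vector of the tail space. -/
noncomputable def tailBasisVector {n : ℕ} (k : Fin n) : EuclideanSpace ℂ {j : Fin n // k ≤ j} :=
  EuclideanSpace.single ⟨k, le_rfl⟩ 1

theorem tailRestrict_reflectionRoot {n : ℕ} {k : Fin n} (x : TailSphere n k) :
    tailRestrict k (reflectionRoot x) = x.1 - tailBasisVector k := by
  ext j
  have hj := j.2
  simp only [tailRestrict, reflectionRoot, tailVector, Pi.sub_apply, dif_pos hj,
    tailBasisVector, PiLp.sub_apply]
  by_cases h : j = ⟨k, le_rfl⟩
  · subst h; simp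
  · have : (j : Fin n) ≠ k := fun h' => h (Subtype.ext h')
    simp [h, this]

theorem inner_tailBasisVector {n : ℕ} (k : Fin n) (x : EuclideanSpace ℂ {j : Fin n // k ≤ j}) :
    inner ℂ (tailBasisVector k) x = x ⟨k, le_rfl⟩ := by
  classical
  simp [tailBasisVector, EuclideanSpace.inner_single_left]

/-- The factor contributed by one reflection, as a function of the coordinates of `e_k - x` in an
orthonormal family starting with `e_k`. It takes the junk value `0` on the null set `y 0 = 0`. -/
noncomputable def reflectionFactor {p : ℕ} (y : EuclideanSpace ℂ (Fin (p + 1))) : ℝ :=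
  ‖y‖ ^ 2 / ‖y 0‖

theorem finrank_tail {n : ℕ} (k : Fin n) :
    Module.finrank ℂ (EuclideanSpace ℂ {j : Fin n // k ≤ j}) = n - k := by
  rw [finrank_euclideanSpace, Fintype.card_subtype]
  have : (Finset.univ.filter fun j : Fin n => k ≤ j) = Finset.Ici k := by ext; simp
  rw [this, Fin.card_Ici]

/-- Given the later vectors, the first one enters only through its coordinates in an orthonormal
family. The family depends on `y`, but the law of these coordinates does not. -/
theorem exists_rootStatistic_eq_mul {l n p : ℕ} (k : Fin (l + 1) → Fin n)
    (hk : ∀ i : Fin l, k 0 < k ((0 : Fin (l + 1)).succAbove i)) (hn : n - k 0 = l + (p + 1))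
    (y : ∀ i : Fin l, TailSphere n (k ((0 : Fin (l + 1)).succAbove i))) :
    ∃ q : Fin (p + 1) → EuclideanSpace ℂ {j : Fin n // k 0 ≤ j}, Orthonormal ℂ q ∧
      ∀ x : ∀ i, TailSphere n (k i), (fun i => x ((0 : Fin (l + 1)).succAbove i)) = y →
        rootStatistic k x =
          reflectionFactor (EuclideanSpace.single 0 1 - WithLp.toLp 2
            fun i => inner ℂ (q i) (x 0).1) *
          rootStatistic (fun i => k ((0 : Fin (l + 1)).succAbove i)) y := by
  obtain ⟨q, hq, hq0, hdet⟩ := exists_orthonormal_det_gram_cons ((finrank_tail (k 0)).trans hn)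
    (tailBasisVector (k 0)) (by simp [tailBasisVector])
    (fun i => tailRestrict (k 0) (reflectionRoot (y i))) (fun j => by
      rw [inner_tailBasisVector]
      exact reflectionRoot_eq_zero _ (not_le.2 (hk j)))
  refine ⟨q, hq, fun x hx => ?_⟩
  have hsupp : ∀ i j, ¬ k 0 ≤ j → reflectionRoot (x i) j = 0 := by
    intro i j hj
    refine reflectionRoot_eq_zero _ fun h => hj (le_trans ?_ h)
    refine Fin.cases le_rfl (fun i => ?_) i
    simpa using (hk i).le
  have hgram : (Matrix.of fun i j => star (reflectionRoot (x i)) ⬝ᵥ reflectionRoot (x j)) =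
      Matrix.gram ℂ (Fin.cons ((x 0).1 - tailBasisVector (k 0))
        (fun i => tailRestrict (k 0) (reflectionRoot (y i))) : Fin (l + 1) → _) := by
    have hfun : (Fin.cons ((x 0).1 - tailBasisVector (k 0))
        (fun i => tailRestrict (k 0) (reflectionRoot (y i))) :
          Fin (l + 1) → EuclideanSpace ℂ {j : Fin n // k 0 ≤ j}) =
        fun i => tailRestrict (k 0) (reflectionRoot (x i)) := by
      funext i
      refine Fin.cases ?_ (fun i => ?_) i
      · rw [Fin.cons_zero, tailRestrict_reflectionRoot]
      · rw [Fin.cons_succ, ← hx]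
        simp
    rw [hfun]
    ext i j
    rw [Matrix.gram_apply, inner_tailRestrict _ _ _ (hsupp i)]
    rfl
  have hgram' : (Matrix.of fun i j => star (reflectionRoot (y i)) ⬝ᵥ reflectionRoot (y j)) =
      Matrix.gram ℂ (fun i => tailRestrict (k 0) (reflectionRoot (y i))) := by
    ext i j
    rw [Matrix.gram_apply, inner_tailRestrict]
    · rfl
    · intro j hj
      exact reflectionRoot_eq_zero _ fun h => hj ((hk _).le.trans h)
  have hco : ∀ i, (EuclideanSpace.single 0 1 - WithLp.toLp 2
      fun i => inner ℂ (q i) (x 0).1 : EuclideanSpace ℂ (Fin (p + 1))) i =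
      -inner ℂ (q i) ((x 0).1 - tailBasisVector (k 0)) := by
    intro i
    rw [inner_sub_right, ← hq0, orthonormal_iff_ite.1 hq]
    simp
  have hlead : ‖1 / (1 - star (tailVector (x 0) (k 0)))‖ = 1 / ‖(EuclideanSpace.single 0 1 -
      WithLp.toLp 2 fun i => inner ℂ (q i) (x 0).1 : EuclideanSpace ℂ (Fin (p + 1))) 0‖ := by
    rw [norm_div, norm_one, tailVector_self, ← inner_tailBasisVector, ← hq0]
    congr 1
    rw [← norm_star]
    simp
  rw [rootStatistic, rootStatistic, hgram, hgram', hdet, Fin.prod_univ_succ, hlead,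
    reflectionFactor, EuclideanSpace.norm_sq_eq, norm_mul]
  simp only [hco, norm_neg]
  rw [Complex.norm_real, Real.norm_of_nonneg (by positivity)]
  subst hx
  simp only [Fin.succAbove_zero]
  ring

theorem rootStatistic_fin_one {n : ℕ} (k : Fin 1 → Fin n) (x : ∀ i, TailSphere n (k i)) :
    rootStatistic k x = (2 - 2 * (inner ℂ (tailBasisVector (k 0)) (x 0).1).re) /
      ‖1 - inner ℂ (tailBasisVector (k 0)) (x 0).1‖ := by
  rw [inner_tailBasisVector, ← tailVector_self]
  set c := tailVector (x 0) (k 0) with hc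
  have hww : star (reflectionRoot (x 0)) ⬝ᵥ reflectionRoot (x 0) =
      ((2 - 2 * c.re : ℝ) : ℂ) := by
    have : (1 - c) + (1 - star c) = ((2 - 2 * c.re : ℝ) : ℂ) := by
      apply Complex.ext
      · simp; ring
      · simp
    rw [← this]
    simp [reflectionRoot, sub_dotProduct, dotProduct_sub, star_tailVector_dotProduct, ← hc]
    ring
  have hre : c.re ≤ 1 := by
    have h1 : ‖(x 0).1 ⟨k 0, le_rfl⟩‖ ≤ ‖(x 0).1‖ := PiLp.norm_apply_le _ _
    rw [norm_eq_of_mem_sphere, ← tailVector_self] at h1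
    exact (Complex.re_le_norm _).trans h1
  have hn : ‖1 - star c‖ = ‖1 - c‖ := by
    rw [← norm_star]; simp
  rw [rootStatistic]
  simp only [Matrix.det_fin_one, Matrix.of_apply, Finset.univ_unique, Finset.prod_singleton,
    Fin.default_eq_zero, hww, Complex.norm_real, norm_div, norm_one]
  rw [Real.norm_of_nonneg (by linarith), ← hc, hn]
  ring

/-! ### Pushing Haar measure forward under homogeneous functions -/

/-- A nonnegative function whose sublevel sets have measure `c * t ^ (k + 1)` pushes the measure
forward to the density `c * (k + 1) * t ^ k` on the positive half-line. -/
theorem map_eq_withDensity_of_measure_lt {X : Type*} [MeasurableSpace X] (μ : Measure X)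
    {φ : X → ℝ} (hφ : Measurable φ) (hpos : ∀ x, 0 ≤ φ x) {k : ℕ} {c : ENNReal} (hc : c ≠ ⊤)
    (h : ∀ t : ℝ, 0 < t → μ {x | φ x < t} = c * ENNReal.ofReal (t ^ (k + 1))) :
    μ.map φ = (c * (k + 1 : ℕ)) •
      (volume.restrict (Set.Ioi 0)).withDensity (fun t => ENNReal.ofReal (t ^ k)) := by
  have h1 : ∀ t : ℝ, μ.map φ (Set.Iio t) =
      if 0 < t then c * ENNReal.ofReal (t ^ (k + 1)) else 0 := by
    intro t
    rw [Measure.map_apply hφ measurableSet_Iio]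
    split_ifs with ht
    · exact h t ht
    · convert measure_empty (μ := μ)
      ext x
      simpa using (not_lt.1 ht).trans (hpos x)
  have h2 : ∀ t : ℝ, ((c * (k + 1 : ℕ)) •
      (volume.restrict (Set.Ioi 0)).withDensity (fun t => ENNReal.ofReal (t ^ k))) (Set.Iio t) =
      if 0 < t then c * ENNReal.ofReal (t ^ (k + 1)) else 0 := by
    intro t
    rw [Measure.smul_apply, withDensity_apply _ measurableSet_Iio,
      Measure.restrict_restrict measurableSet_Iio, Set.Iio_inter_Ioi, smul_eq_mul]
    split_ifs with ht
    · rw [mul_assoc]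
      congr 1
      rw [Measure.restrict_congr_set Ioo_ae_eq_Ioc, ← ofReal_integral_eq_lintegral_ofReal
        (intervalIntegrable_iff_integrableOn_Ioc_of_le ht.le |>.1
          (intervalIntegral.intervalIntegrable_pow _)),
        ← intervalIntegral.integral_of_le ht.le, integral_pow, ← ENNReal.ofReal_natCast,
        ← ENNReal.ofReal_mul (by positivity)]
      · congr 1
        push_cast
        field_simp
        simp
      · filter_upwards [ae_restrict_mem measurableSet_Ioc] with y hy
        exact pow_nonneg hy.1.le _
    · rw [Set.Ioo_eq_empty ht]
      simp
  refine Measure.ext_of_generateFrom_of_iUnion (Set.range Set.Iio) (fun i : ℕ => Set.Iio (i : ℝ))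
    ((BorelSpace.measurable_eq (α := ℝ)).trans (borel_eq_generateFrom_Iio ℝ)) ?_ ?_ (by simp) ?_ ?_
  · rintro _ ⟨a, rfl⟩ _ ⟨b, rfl⟩ _
    exact ⟨min a b, Set.Iio_inter_Iio.symm⟩
  · refine Set.iUnion_eq_univ_iff.2 fun x => ?_
    exact exists_nat_gt x
  · intro i
    rw [h1]
    split_ifs
    · exact ENNReal.mul_ne_top hc ENNReal.ofReal_ne_top
    · simp
  · rintro _ ⟨t, rfl⟩
    rw [h1, h2]

open scoped Pointwise in
theorem measure_lt_of_homogeneous {E : Type*} [NormedAddCommGroup E] [NormedSpace ℝ E]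
    [MeasurableSpace E] [BorelSpace E] [FiniteDimensional ℝ E] (μ : Measure E)
    [μ.IsAddHaarMeasure] {φ : E → ℝ} (hφ : ∀ (t : ℝ) x, 0 < t → φ (t • x) = t * φ x) {t : ℝ}
    (ht : 0 < t) :
    μ {x | φ x < t} = μ {x | φ x < 1} * ENNReal.ofReal (t ^ Module.finrank ℝ E) := by
  have : {x | φ x < t} = t • {x | φ x < 1} := by
    ext x
    rw [Set.mem_smul_set_iff_inv_smul_mem₀ ht.ne']
    simp only [Set.mem_ofPred_eq]
    rw [hφ _ _ (inv_pos.2 ht), inv_mul_lt_iff₀ ht, mul_one]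
  rw [this, Measure.addHaar_smul, abs_of_nonneg (by positivity), mul_comm]

theorem lintegral_norm_sq {B : Type*} [NormedAddCommGroup B] [NormedSpace ℝ B]
    [MeasurableSpace B] [BorelSpace B] [FiniteDimensional ℝ B] (μ : Measure B)
    [μ.IsAddHaarMeasure] {b : ℕ} (hb : Module.finrank ℝ B = 2 * (b + 1)) {F : ℝ → ENNReal}
    (hF : Measurable F) :
    ∫⁻ z, F (‖z‖ ^ 2) ∂μ = μ (Metric.ball 0 1) * (b + 1 : ℕ) *
      ∫⁻ t in Set.Ioi 0, ENNReal.ofReal (t ^ b) * F t := by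
  have hm : Measurable fun z : B => ‖z‖ ^ 2 := by fun_prop
  have : Nontrivial B := Module.nontrivial_of_finrank_pos (R := ℝ) (by omega)
  have hlt : ∀ t : ℝ, 0 < t → μ {z | ‖z‖ ^ 2 < t} =
      μ (Metric.ball 0 1) * ENNReal.ofReal (t ^ (b + 1)) := by
    intro t ht
    have h1 : {z : B | ‖z‖ ^ 2 < t} = Metric.ball 0 (√t) := by
      ext z
      simp [Real.lt_sqrt]
    rw [h1, Measure.addHaar_ball _ _ (Real.sqrt_nonneg t), hb, pow_mul, Real.sq_sqrt ht.le,
      mul_comm]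
  rw [← lintegral_map hF hm, map_eq_withDensity_of_measure_lt μ hm (fun z => by positivity)
    measure_ball_lt_top.ne hlt, lintegral_smul_measure,
    lintegral_withDensity_eq_lintegral_mul _ (by fun_prop) hF]
  rfl

theorem lintegral_inv_smul {E : Type*} [NormedAddCommGroup E] [NormedSpace ℝ E]
    [MeasurableSpace E] [BorelSpace E] [FiniteDimensional ℝ E] (μ : Measure E)
    [μ.IsAddHaarMeasure] {f : E → ENNReal} (hf : Measurable f) {r : ℝ} (hr : 0 < r) :
    ∫⁻ x, f (r⁻¹ • x) ∂μ = ENNReal.ofReal (r ^ Module.finrank ℝ E) * ∫⁻ x, f x ∂μ := by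
  rw [← lintegral_map hf (by fun_prop), Measure.map_addHaar_smul _ (inv_ne_zero hr.ne'),
    lintegral_smul_measure, inv_pow, inv_inv, abs_of_nonneg (by positivity), smul_eq_mul]

/-! ### Projections of the uniform measure on a sphere -/

open scoped Pointwise in
theorem map_coe_toSphere {E : Type*} [NormedAddCommGroup E] [NormedSpace ℝ E]
    [MeasurableSpace E] [BorelSpace E] [FiniteDimensional ℝ E] [Nontrivial E] (μ : Measure E)
    [μ.IsAddHaarMeasure] :
    μ.toSphere.map Subtype.val =
      (Module.finrank ℝ E : ENNReal) • (μ.restrict (Metric.ball 0 1)).map fun x => ‖x‖⁻¹ • x := by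
  have hm : Measurable fun x : E => ‖x‖⁻¹ • x := by fun_prop
  ext s hs
  rw [Measure.map_apply measurable_subtype_coe hs, Measure.smul_apply, Measure.map_apply hm hs,
    Measure.restrict_apply (hm hs), Measure.toSphere_apply' _ (measurable_subtype_coe hs),
    smul_eq_mul]
  congr 1
  rw [← measure_sdiff_null (s := (fun x : E => ‖x‖⁻¹ • x) ⁻¹' s ∩ Metric.ball 0 1)
    (measure_singleton (0 : E))]
  congr 1
  ext x
  simp only [Set.mem_smul, Set.mem_image, Set.mem_preimage, Set.mem_sdiff, Set.mem_inter_iff,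
    mem_ball_zero_iff, Set.mem_singleton_iff]
  constructor
  · rintro ⟨r, hr, _, ⟨y, hy, rfl⟩, rfl⟩
    have hy1 : ‖(y : E)‖ = 1 := norm_eq_of_mem_sphere y
    have hn : ‖r • (y : E)‖ = r := by rw [norm_smul, hy1, mul_one, Real.norm_of_nonneg hr.1.le]
    refine ⟨⟨?_, ?_⟩, ?_⟩
    · rwa [hn, smul_smul, inv_mul_cancel₀ hr.1.ne', one_smul]
    · rw [hn]; exact hr.2
    · intro h0
      rw [h0, norm_zero] at hn
      exact hr.1.ne hn
  · rintro ⟨⟨hxs, hx1⟩, hx0⟩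
    have hx : 0 < ‖x‖ := norm_pos_iff.2 hx0
    refine ⟨‖x‖, ⟨hx, hx1⟩, ‖x‖⁻¹ • x, ⟨⟨‖x‖⁻¹ • x, ?_⟩, hxs, rfl⟩, ?_⟩
    · simp [norm_smul, hx.ne']
    · rw [smul_smul, mul_inv_cancel₀ hx.ne', one_smul]

theorem lintegral_toSphere {E : Type*} [NormedAddCommGroup E] [NormedSpace ℝ E]
    [MeasurableSpace E] [BorelSpace E] [FiniteDimensional ℝ E] [Nontrivial E] (μ : Measure E)
    [μ.IsAddHaarMeasure] {g : E → ENNReal} (hg : Measurable g) :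
    ∫⁻ x, g x.1 ∂μ.toSphere =
      Module.finrank ℝ E * ∫⁻ x in Metric.ball 0 1, g (‖x‖⁻¹ • x) ∂μ := by
  rw [← lintegral_map hg measurable_subtype_coe, map_coe_toSphere, lintegral_smul_measure,
    lintegral_map hg (by fun_prop), smul_eq_mul]

theorem exists_lintegral_prod_norm_sq {E A B : Type*}
    [NormedAddCommGroup E] [NormedSpace ℝ E] [MeasurableSpace E] [BorelSpace E]
    [NormedAddCommGroup A] [NormedSpace ℝ A] [MeasurableSpace A] [BorelSpace A]
    [NormedAddCommGroup B] [NormedSpace ℝ B] [MeasurableSpace B] [BorelSpace B]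
    [FiniteDimensional ℝ A] [FiniteDimensional ℝ B]
    (μ : Measure E) (ν : Measure A) (ρ : Measure B) [μ.IsAddHaarMeasure] [ν.IsAddHaarMeasure]
    [ρ.IsAddHaarMeasure] (L : E ≃L[ℝ] A × B) {b : ℕ} (hb : Module.finrank ℝ B = 2 * (b + 1)) :
    ∃ C : ENNReal, ∀ G : A × ℝ → ENNReal, Measurable G →
      ∫⁻ x, G ((L x).1, ‖(L x).2‖ ^ 2) ∂μ =
        C * ∫⁻ y, (∫⁻ t in Set.Ioi (0 : ℝ), ENNReal.ofReal (t ^ b) * G (y, t)) ∂ν := by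
  have : (μ.map L).IsAddHaarMeasure := L.isAddHaarMeasure_map μ
  obtain ⟨c, hmap⟩ : ∃ c : ENNReal, μ.map L = c • ν.prod ρ :=
    ⟨_, Measure.isAddLeftInvariant_eq_smul (μ.map L) (ν.prod ρ)⟩
  refine ⟨c * (ρ (Metric.ball 0 1) * (b + 1 : ℕ)), fun G hG => ?_⟩
  have hG' : Measurable fun q : A × B => G (q.1, ‖q.2‖ ^ 2) :=
    hG.comp (by fun_prop : Measurable fun q : A × B => (q.1, ‖q.2‖ ^ 2))
  have hpush : ∫⁻ x, G ((L x).1, ‖(L x).2‖ ^ 2) ∂μ = ∫⁻ q, G (q.1, ‖q.2‖ ^ 2) ∂(μ.map L) :=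
    (lintegral_map hG' L.continuous.measurable).symm
  have hm : Measurable fun q : A × ℝ => ENNReal.ofReal (q.2 ^ b) * G (q.1, q.2) :=
    (by fun_prop : Measurable fun q : A × ℝ => ENNReal.ofReal (q.2 ^ b)).mul hG
  rw [hpush, hmap, lintegral_smul_measure, lintegral_prod _ hG'.aemeasurable, smul_eq_mul,
    mul_assoc, ← lintegral_const_mul _ hm.lintegral_prod_right']
  congr 1
  refine lintegral_congr fun y => ?_
  exact lintegral_norm_sq ρ hb (hG.comp (by fun_prop : Measurable fun t : ℝ => (y, t)))

/-- A uniform point of the sphere of `A × B`, projected to `A`, has density proportional to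
`(1 - ‖y‖ ^ 2) ^ b` on the unit ball, where `B` has complex dimension `b + 1`: with `t = ‖z‖ ^ 2`
the squared norm `R = ‖y‖ ^ 2 + t` becomes a coordinate, and scaling by `√R` separates it. -/
theorem exists_lintegral_normalize_fst {E A B : Type*}
    [NormedAddCommGroup E] [NormedSpace ℝ E] [MeasurableSpace E] [BorelSpace E]
    [NormedAddCommGroup A] [NormedSpace ℝ A] [MeasurableSpace A] [BorelSpace A]
    [NormedAddCommGroup B] [NormedSpace ℝ B] [MeasurableSpace B] [BorelSpace B]
    [FiniteDimensional ℝ A] [FiniteDimensional ℝ B]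
    (μ : Measure E) (ν : Measure A) (ρ : Measure B) [μ.IsAddHaarMeasure] [ν.IsAddHaarMeasure]
    [ρ.IsAddHaarMeasure] (L : E ≃L[ℝ] A × B)
    (hL : ∀ x, ‖x‖ ^ 2 = ‖(L x).1‖ ^ 2 + ‖(L x).2‖ ^ 2) {a b : ℕ}
    (ha : Module.finrank ℝ A = 2 * a) (hb : Module.finrank ℝ B = 2 * (b + 1)) :
    ∃ C : ENNReal, ∀ g : A → ENNReal, Measurable g →
      ∫⁻ x in Metric.ball 0 1, g (‖x‖⁻¹ • (L x).1) ∂μ =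
        C * ∫⁻ y in Metric.ball 0 1, g y * ENNReal.ofReal ((1 - ‖y‖ ^ 2) ^ b) ∂ν := by
  classical
  obtain ⟨c, hc⟩ := exists_lintegral_prod_norm_sq μ ν ρ L hb
  refine ⟨c * ∫⁻ R in Set.Ioo (0 : ℝ) 1, ENNReal.ofReal (R ^ a * R ^ b), fun g hg => ?_⟩
  have hI : Measurable ((Set.Iio (1 : ℝ)).indicator (1 : ℝ → ENNReal)) :=
    measurable_one.indicator measurableSet_Iio
  have hG : Measurable fun q : A × ℝ =>
      (Set.Iio (1 : ℝ)).indicator 1 (‖q.1‖ ^ 2 + q.2) * g ((√(‖q.1‖ ^ 2 + q.2))⁻¹ • q.1) :=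
    (hI.comp (by fun_prop : Measurable fun q : A × ℝ => ‖q.1‖ ^ 2 + q.2)).mul
      (hg.comp (by fun_prop : Measurable fun q : A × ℝ => (√(‖q.1‖ ^ 2 + q.2))⁻¹ • q.1))
  have step1 : ∀ x, (Metric.ball (0 : E) 1).indicator (fun x => g (‖x‖⁻¹ • (L x).1)) x =
      (Set.Iio (1 : ℝ)).indicator 1 (‖(L x).1‖ ^ 2 + ‖(L x).2‖ ^ 2) *
        g ((√(‖(L x).1‖ ^ 2 + ‖(L x).2‖ ^ 2))⁻¹ • (L x).1) := by
    intro x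
    rw [← hL, Real.sqrt_sq (norm_nonneg x)]
    simp only [Set.indicator_apply, mem_ball_zero_iff,
      Set.mem_Iio, sq_lt_one_iff₀ (norm_nonneg x), Pi.one_apply]
    split_ifs <;> simp
  have step2 : ∀ y : A, ∫⁻ t in Set.Ioi 0, ENNReal.ofReal (t ^ b) *
      ((Set.Iio (1 : ℝ)).indicator 1 (‖y‖ ^ 2 + t) * g ((√(‖y‖ ^ 2 + t))⁻¹ • y)) =
      ∫⁻ R, (Set.Ioi (0 : ℝ)).indicator 1 (R - ‖y‖ ^ 2) * (ENNReal.ofReal ((R - ‖y‖ ^ 2) ^ b) *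
        ((Set.Iio (1 : ℝ)).indicator 1 R * g ((√R)⁻¹ • y))) := by
    intro y
    rw [← lintegral_indicator measurableSet_Ioi, ← lintegral_sub_right_eq_self _ (‖y‖ ^ 2)]
    refine lintegral_congr fun R => ?_
    simp only [Set.indicator_apply, Pi.one_apply, add_sub_cancel]
    split_ifs <;> simp
  have hm2 : Measurable fun q : A × ℝ => (Set.Ioi (0 : ℝ)).indicator (1 : ℝ → ENNReal)
      (q.2 - ‖q.1‖ ^ 2) * (ENNReal.ofReal ((q.2 - ‖q.1‖ ^ 2) ^ b) *
        ((Set.Iio (1 : ℝ)).indicator 1 q.2 * g ((√q.2)⁻¹ • q.1))) := by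
    have h2 : Measurable ((Set.Ioi (0 : ℝ)).indicator (1 : ℝ → ENNReal)) :=
      measurable_one.indicator measurableSet_Ioi
    have h3 : Measurable fun q : A × ℝ => (√q.2)⁻¹ • q.1 := by fun_prop
    exact (h2.comp (by fun_prop)).mul ((by fun_prop : Measurable fun q : A × ℝ =>
      ENNReal.ofReal ((q.2 - ‖q.1‖ ^ 2) ^ b)).mul ((hI.comp measurable_snd).mul (hg.comp h3)))
  have step3 : ∀ R : ℝ, ∫⁻ y, (Set.Ioi (0 : ℝ)).indicator 1 (R - ‖y‖ ^ 2) *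
      (ENNReal.ofReal ((R - ‖y‖ ^ 2) ^ b) *
        ((Set.Iio (1 : ℝ)).indicator 1 R * g ((√R)⁻¹ • y))) ∂ν =
      (Set.Ioo (0 : ℝ) 1).indicator (fun R => ENNReal.ofReal (R ^ a * R ^ b)) R *
        ∫⁻ y in Metric.ball 0 1, g y * ENNReal.ofReal ((1 - ‖y‖ ^ 2) ^ b) ∂ν := by
    intro R
    by_cases hR : R ∈ Set.Ioo (0 : ℝ) 1
    · have hs : 0 < √R := Real.sqrt_pos.2 hR.1
      set f : A → ENNReal := (Metric.ball 0 1).indicator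
        (fun y => g y * ENNReal.ofReal ((1 - ‖y‖ ^ 2) ^ b)) with hf
      have hfm : Measurable f := (hg.mul (by fun_prop)).indicator Metric.isOpen_ball.measurableSet
      rw [Set.indicator_of_mem hR, ENNReal.ofReal_mul (pow_nonneg hR.1.le _), mul_right_comm,
        ← lintegral_indicator Metric.isOpen_ball.measurableSet, ← hf]
      have := lintegral_inv_smul ν hfm hs
      rw [ha, pow_mul, Real.sq_sqrt hR.1.le] at this
      rw [← this, mul_comm, ← lintegral_const_mul _ (by fun_prop)]
      refine lintegral_congr fun y => ?_
      have hn : ‖(√R)⁻¹ • y‖ ^ 2 = ‖y‖ ^ 2 / R := by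
        rw [norm_smul, mul_pow, norm_inv, inv_pow, Real.norm_of_nonneg hs.le,
          Real.sq_sqrt hR.1.le]
        ring
      have hiff : ‖(√R)⁻¹ • y‖ < 1 ↔ 0 < R - ‖y‖ ^ 2 := by
        rw [← sq_lt_one_iff₀ (norm_nonneg _), hn, div_lt_one hR.1, sub_pos]
      simp only [hf, Set.indicator_apply, mem_ball_zero_iff, hiff, Set.mem_Ioi, Set.mem_Iio, hR.2,
        if_true, Pi.one_apply, hn]
      split_ifs with h
      · have hq : 0 < 1 - ‖y‖ ^ 2 / R := by
          rw [sub_pos, div_lt_one hR.1]; linarith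
        have hpow : (R - ‖y‖ ^ 2) ^ b = R ^ b * (1 - ‖y‖ ^ 2 / R) ^ b := by
          rw [← mul_pow]
          congr 1
          have := hR.1.ne'
          field_simp
        rw [hpow, ENNReal.ofReal_mul (pow_nonneg hR.1.le _)]
        ring
      · simp
    · rw [Set.indicator_of_notMem hR, zero_mul, ← lintegral_zero (μ := ν)]
      refine lintegral_congr fun y => ?_
      simp only [Set.indicator_apply, Set.mem_Ioi, Set.mem_Iio, Pi.one_apply]
      split_ifs with h1 h2
      · exact absurd ⟨by nlinarith [sq_nonneg ‖y‖], h2⟩ hR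
      all_goals simp
  rw [← lintegral_indicator Metric.isOpen_ball.measurableSet, lintegral_congr step1, hc _ hG,
    lintegral_congr step2, lintegral_lintegral_swap hm2.aemeasurable, lintegral_congr step3,
    lintegral_mul_const _ ((by fun_prop : Measurable fun R : ℝ =>
      ENNReal.ofReal (R ^ a * R ^ b)).indicator measurableSet_Ioo),
    lintegral_indicator measurableSet_Ioo]
  ring

/-! ### Coordinates of a uniform point of the tail sphere -/

/-- The measure with density `(1 - ‖y‖ ^ 2) ^ b` on the unit ball of `ℂᵃ`. -/
noncomputable def ballWeight (a b : ℕ) : Measure (EuclideanSpace ℂ (Fin a)) :=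
  (volume.restrict (Metric.ball 0 1)).withDensity fun y => ENNReal.ofReal ((1 - ‖y‖ ^ 2) ^ b)

theorem finrank_real_euclideanSpace (ι : Type*) [Fintype ι] :
    Module.finrank ℝ (EuclideanSpace ℂ ι) = 2 * Fintype.card ι := by
  rw [finrank_real_of_complex, finrank_euclideanSpace]

instance nontrivial_tail {n : ℕ} (k : Fin n) :
    Nontrivial (EuclideanSpace ℂ {j : Fin n // k ≤ j}) :=
  Module.nontrivial_of_finrank_pos (R := ℂ) (by rw [finrank_tail]; omega)

instance isProbabilityMeasure_uniformTailSphere {n : ℕ} (k : Fin n) :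
    IsProbabilityMeasure (uniformTailSphere n k) := by
  refine ⟨?_⟩
  rw [uniformTailSphere, Measure.smul_apply, smul_eq_mul]
  refine ENNReal.inv_mul_cancel ?_ (measure_ne_top _ _)
  rw [Ne, Measure.measure_univ_eq_zero]
  exact Measure.toSphere_ne_zero _

theorem exists_lintegral_uniformTailSphere {n : ℕ} (k : Fin n) :
    ∃ C : ENNReal, ∀ g : EuclideanSpace ℂ {j : Fin n // k ≤ j} → ENNReal, Measurable g →
      ∫⁻ x, g x.1 ∂(uniformTailSphere n k) =
        C * ∫⁻ x in Metric.ball 0 1, g (‖x‖⁻¹ • x) := by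
  refine ⟨((volume : Measure (EuclideanSpace ℂ {j : Fin n // k ≤ j})).toSphere Set.univ)⁻¹ *
    Module.finrank ℝ (EuclideanSpace ℂ {j : Fin n // k ≤ j}), fun g hg => ?_⟩
  rw [uniformTailSphere, lintegral_smul_measure, lintegral_toSphere _ hg, smul_eq_mul, ← mul_assoc]

/-- A probability measure determines the constant in its proportionality to another measure. -/
theorem eq_inv_smul_of_isProbabilityMeasure {X : Type*} [MeasurableSpace X] {μ ν : Measure X}
    [IsProbabilityMeasure μ] {C : ENNReal} (h : μ = C • ν) : μ = (ν Set.univ)⁻¹ • ν := by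
  have h1 : C * ν Set.univ = 1 := by
    have := measure_univ (μ := μ)
    rwa [h, Measure.smul_apply, smul_eq_mul] at this
  rw [← ENNReal.eq_inv_of_mul_eq_one_left h1]
  exact h

/-- The coordinates of a uniform point in an orthonormal family. The law depends only on the number
of coordinates and on the codimension `b + 1` that is left. -/
theorem map_coord_uniformTailSphere {n a b : ℕ} (k : Fin n) (h : n - k = a + (b + 1))
    (q : Fin a → EuclideanSpace ℂ {j : Fin n // k ≤ j}) (hq : Orthonormal ℂ q) :
    (uniformTailSphere n k).map (fun x => WithLp.toLp 2 fun i => inner ℂ (q i) x.1) =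
      (ballWeight a b Set.univ)⁻¹ • ballWeight a b := by
  have hv : Orthonormal ℂ ((Set.range (Sum.inl : Fin a → Fin a ⊕ Fin (b + 1))).domRestrict
      (Sum.elim q fun _ => 0)) := by
    have he : (Set.range (Sum.inl : Fin a → Fin a ⊕ Fin (b + 1))).domRestrict
        (Sum.elim q fun _ => 0) =
        q ∘ (Equiv.ofInjective (Sum.inl : Fin a → Fin a ⊕ Fin (b + 1)) Sum.inl_injective).symm := by
      funext ⟨_, i, rfl⟩
      simp [Set.domRestrict]
    rw [he]
    exact hq.comp _ (Equiv.injective _)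
  obtain ⟨B, hB⟩ := Orthonormal.exists_orthonormalBasis_extension_of_card_eq
    (ι := Fin a ⊕ Fin (b + 1)) (by rw [finrank_tail, h]; simp) hv
  have hBq : ∀ i, B (Sum.inl i) = q i := fun i => by rw [hB _ ⟨i, rfl⟩]; rfl
  let L₀ : EuclideanSpace ℂ {j : Fin n // k ≤ j} →ₗ[ℝ]
      EuclideanSpace ℂ (Fin a) × EuclideanSpace ℂ (Fin (b + 1)) :=
    { toFun := fun x => (WithLp.toLp 2 fun i => inner ℂ (B (Sum.inl i)) x,
        WithLp.toLp 2 fun i => inner ℂ (B (Sum.inr i)) x)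
      map_add' := fun x y => by ext <;> simp
      map_smul' := fun c x => by ext <;> simp [inner_smul_right_eq_smul] }
  have hnorm : ∀ x, ‖x‖ ^ 2 = ‖(L₀ x).1‖ ^ 2 + ‖(L₀ x).2‖ ^ 2 := by
    intro x
    rw [← B.sum_sq_norm_inner_right x, Fintype.sum_sum_type, EuclideanSpace.norm_sq_eq,
      EuclideanSpace.norm_sq_eq]
    rfl
  have hinj : Function.Injective L₀ := by
    rw [injective_iff_map_eq_zero]
    intro x hx
    have := hnorm x
    rw [hx] at this
    simpa using this
  have hdim : Module.finrank ℝ (EuclideanSpace ℂ {j : Fin n // k ≤ j}) =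
      Module.finrank ℝ (EuclideanSpace ℂ (Fin a) × EuclideanSpace ℂ (Fin (b + 1))) := by
    rw [Module.finrank_prod, finrank_real_of_complex, finrank_tail,
      finrank_real_euclideanSpace, finrank_real_euclideanSpace, h]
    simp
    ring
  let L := (L₀.linearEquivOfInjective hinj hdim).toContinuousLinearEquiv
  have hL : ∀ x, L x = L₀ x := fun x => rfl
  obtain ⟨C, hC⟩ := exists_lintegral_normalize_fst volume volume volume L
    (fun x => by rw [hL]; exact hnorm x) (a := a) (b := b)
    (by simp [finrank_real_euclideanSpace]) (by simp [finrank_real_euclideanSpace])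
  obtain ⟨C', hC'⟩ := exists_lintegral_uniformTailSphere k
  have hcont : Continuous fun x : EuclideanSpace ℂ {j : Fin n // k ≤ j} => (L x).1 := by fun_prop
  have hz : ∀ x, (L x).1 = WithLp.toLp 2 fun i => inner ℂ (q i) x := by
    intro x
    simp_rw [← hBq]
    rfl
  have hmz : Measurable fun x : TailSphere n k =>
      (WithLp.toLp 2 fun i => inner ℂ (q i) x.1 : EuclideanSpace ℂ (Fin a)) := by
    simp_rw [← hz]
    exact hcont.measurable.comp measurable_subtype_coe
  have : IsProbabilityMeasure ((uniformTailSphere n k).map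
      (fun x => (WithLp.toLp 2 fun i => inner ℂ (q i) x.1 : EuclideanSpace ℂ (Fin a)))) :=
    Measure.isProbabilityMeasure_map hmz.aemeasurable
  refine eq_inv_smul_of_isProbabilityMeasure (C := C' * C) (Measure.ext_of_lintegral _ ?_)
  intro g hg
  rw [lintegral_map hg hmz, lintegral_smul_measure, ballWeight,
    lintegral_withDensity_eq_lintegral_mul _ (by fun_prop) hg]
  simp_rw [← hz]
  rw [hC' (fun x => g (L x).1) (hg.comp hcont.measurable)]
  simp_rw [map_smul, Prod.smul_fst]
  rw [hC g hg, smul_eq_mul, mul_assoc]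
  congr 3
  funext y
  simp [mul_comm]

theorem exists_lintegral_comp_equiv {E A : Type*}
    [NormedAddCommGroup E] [NormedSpace ℝ E] [MeasurableSpace E] [BorelSpace E]
    [NormedAddCommGroup A] [NormedSpace ℝ A] [MeasurableSpace A] [BorelSpace A]
    [FiniteDimensional ℝ A] (μ : Measure E) (ν : Measure A) [μ.IsAddHaarMeasure]
    [ν.IsAddHaarMeasure] (L : E ≃L[ℝ] A) :
    ∃ C : ENNReal, ∀ g : A → ENNReal, Measurable g → ∫⁻ x, g (L x) ∂μ = C * ∫⁻ y, g y ∂ν := by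
  have : (μ.map L).IsAddHaarMeasure := L.isAddHaarMeasure_map μ
  obtain ⟨c, hmap⟩ : ∃ c : ENNReal, μ.map L = c • ν :=
    ⟨_, Measure.isAddLeftInvariant_eq_smul (μ.map L) ν⟩
  refine ⟨c, fun g hg => ?_⟩
  rw [← lintegral_map hg L.continuous.measurable, hmap, lintegral_smul_measure, smul_eq_mul]

/-- In complex dimension at least two, the first coordinate of a uniform point of the sphere. -/
theorem exists_lintegral_coord_uniformTailSphere {n b : ℕ} (k : Fin n) (h : n - k = b + 2) :
    ∃ C : ENNReal, ∀ g : ℂ → ENNReal, Measurable g →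
      ∫⁻ x, g (inner ℂ (tailBasisVector k) x.1) ∂(uniformTailSphere n k) =
        C * ∫⁻ z in Metric.ball (0 : ℂ) 1, ENNReal.ofReal ((1 - ‖z‖ ^ 2) ^ b) * g z := by
  have hq : Orthonormal ℂ (fun _ : Fin 1 => tailBasisVector k) := by
    refine ⟨fun i => by simp [tailBasisVector], fun i j hij => ?_⟩
    exact absurd (Subsingleton.elim i j) hij
  have hmap := map_coord_uniformTailSphere (a := 1) (b := b) k (by omega) _ hq
  let L : EuclideanSpace ℂ (Fin 1) ≃L[ℝ] ℂ :=
    (((EuclideanSpace.equiv (Fin 1) ℂ).trans (ContinuousLinearEquiv.funUnique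
      (Fin 1) ℂ ℂ)).toLinearEquiv.restrictScalars ℝ).toContinuousLinearEquiv
  have hL : ∀ y, L y = y 0 := fun y => rfl
  have hLn : ∀ y, ‖L y‖ = ‖y‖ := by
    intro y
    rw [EuclideanSpace.norm_eq, hL]
    simp
  obtain ⟨C, hC⟩ := exists_lintegral_comp_equiv volume volume L
  refine ⟨(ballWeight 1 b Set.univ)⁻¹ * C, fun g hg => ?_⟩
  have hgL : Measurable fun y => g (L y) := hg.comp L.continuous.measurable
  have hmz : Measurable fun x : TailSphere n k =>
      (WithLp.toLp 2 fun _ => inner ℂ (tailBasisVector k) x.1 : EuclideanSpace ℂ (Fin 1)) := by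
    refine Continuous.measurable ?_
    fun_prop
  have h1 : ∫⁻ x, g (inner ℂ (tailBasisVector k) x.1) ∂(uniformTailSphere n k) =
      ∫⁻ y, g (L y) ∂((uniformTailSphere n k).map
        (fun x => WithLp.toLp 2 fun _ => inner ℂ (tailBasisVector k) x.1)) :=
    (lintegral_map hgL hmz).symm
  rw [h1, hmap, lintegral_smul_measure, ballWeight,
    lintegral_withDensity_eq_lintegral_mul _ (by fun_prop) hgL, smul_eq_mul, mul_assoc]
  congr 1
  rw [← lintegral_indicator Metric.isOpen_ball.measurableSet,
    ← lintegral_indicator Metric.isOpen_ball.measurableSet, ← hC]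
  · refine lintegral_congr fun y => ?_
    classical
    simp [Set.indicator_apply, hLn]
  · exact ((by fun_prop : Measurable fun z : ℂ =>
      ENNReal.ofReal ((1 - ‖z‖ ^ 2) ^ b)).mul hg).indicator Metric.isOpen_ball.measurableSet

/-- In complex dimension one, the first coordinate is uniform on the unit circle. -/
theorem exists_lintegral_coord_uniformTailSphere_one {n : ℕ} (k : Fin n) (h : n - k = 1) :
    ∃ C : ENNReal, ∀ g : ℂ → ENNReal, Measurable g →
      ∫⁻ x, g (inner ℂ (tailBasisVector k) x.1) ∂(uniformTailSphere n k) =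
        C * ∫⁻ z in Metric.ball (0 : ℂ) 1, g (‖z‖⁻¹ • z) := by
  obtain ⟨C', hC'⟩ := exists_lintegral_uniformTailSphere k
  have hsub : Subsingleton {j : Fin n // k ≤ j} := by
    refine ⟨fun i j => Subtype.ext (Fin.ext ?_)⟩
    have h1 := i.1.2
    have h2 := j.1.2
    have h3 : (k : ℕ) ≤ i.1 := i.2
    have h4 : (k : ℕ) ≤ j.1 := j.2
    omega
  let u : Unique {j : Fin n // k ≤ j} := ⟨⟨⟨k, le_rfl⟩⟩, fun _ => Subsingleton.elim _ _⟩
  let L : EuclideanSpace ℂ {j : Fin n // k ≤ j} ≃L[ℝ] ℂ :=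
    (((EuclideanSpace.equiv {j : Fin n // k ≤ j} ℂ).trans (ContinuousLinearEquiv.funUnique
      {j : Fin n // k ≤ j} ℂ ℂ)).toLinearEquiv.restrictScalars ℝ).toContinuousLinearEquiv
  have hL : ∀ y, L y = inner ℂ (tailBasisVector k) y := fun y => by
    rw [inner_tailBasisVector]
    rfl
  have hLn : ∀ y, ‖L y‖ = ‖y‖ := by
    intro y
    rw [EuclideanSpace.norm_eq, Fintype.sum_unique, Real.sqrt_sq (norm_nonneg _)]
    rfl
  obtain ⟨C, hC⟩ := exists_lintegral_comp_equiv volume volume L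
  refine ⟨C' * C, fun g hg => ?_⟩
  have hgL : Measurable fun y => g (L y) := hg.comp L.continuous.measurable
  simp_rw [← hL]
  rw [hC' _ hgL, mul_assoc]
  congr 1
  rw [← lintegral_indicator Metric.isOpen_ball.measurableSet,
    ← lintegral_indicator Metric.isOpen_ball.measurableSet, ← hC]
  · refine lintegral_congr fun y => ?_
    classical
    simp [Set.indicator_apply, hLn]
  · exact (hg.comp (by fun_prop : Measurable fun z : ℂ => ‖z‖⁻¹ • z)).indicator
      Metric.isOpen_ball.measurableSet

/-! ### The factor of the last reflection -/

/-- The measure `μ` on the line has a version of its density that is equivalent to a positive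
multiple of `ε ^ m` as `ε` tends to `0` from the right. -/
def HasPowerDensity (m : ℕ) (μ : Measure ℝ) : Prop :=
  ∃ d : ℝ, 0 < d ∧ ∃ h : ℝ → ℝ, Measurable h ∧ (∀ x, 0 ≤ h x) ∧
    μ = volume.withDensity (fun x => ENNReal.ofReal (h x)) ∧
    Asymptotics.IsEquivalent (nhdsWithin 0 (Set.Ioi 0)) h (fun ε => d * ε ^ m)

theorem setLIntegral_two_mul_cos_of_injOn {s : Set ℝ} (hs : MeasurableSet s)
    (hinj : Set.InjOn (fun φ => 2 * Real.cos φ) s)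
    (himage : (fun φ => 2 * Real.cos φ) '' s = Set.Ioo 0 2) (hsin : ∀ φ ∈ s, Real.sin φ ≠ 0)
    (H : ℝ → ENNReal) :
    ∫⁻ φ in s, H (2 * Real.cos φ) =
      ∫⁻ y in Set.Ioo 0 2, ENNReal.ofReal (√(4 - y ^ 2))⁻¹ * H y := by
  rw [← himage, lintegral_image_eq_lintegral_abs_deriv_mul hs (f' := fun φ => 2 * -Real.sin φ)
    (fun φ _ => ((Real.hasDerivAt_cos φ).const_mul 2).hasDerivWithinAt) hinj]
  refine setLIntegral_congr_fun hs fun φ hφ => ?_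
  have h1 : √(4 - (2 * Real.cos φ) ^ 2) = |2 * -Real.sin φ| := by
    rw [← Real.sqrt_sq_eq_abs]
    congr 1
    nlinarith [Real.sin_sq_add_cos_sq φ]
  have h2 : |2 * -Real.sin φ| ≠ 0 := by
    simpa using hsin φ hφ
  rw [← mul_assoc, ← ENNReal.ofReal_mul (abs_nonneg _), h1, mul_inv_cancel₀ h2]
  simp

theorem setLIntegral_two_mul_cos (H : ℝ → ENNReal) :
    ∫⁻ φ in Set.Ioo (-(Real.pi / 2)) (Real.pi / 2), H (2 * Real.cos φ) =
      2 * ∫⁻ y in Set.Ioo 0 2, ENNReal.ofReal (√(4 - y ^ 2))⁻¹ * H y := by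
  have hpi := Real.pi_pos
  rw [← Set.Ioc_union_Ioo_eq_Ioo (b := 0) (by linarith) (by linarith),
    lintegral_union measurableSet_Ioo, Measure.restrict_congr_set Ioo_ae_eq_Ioc.symm,
    setLIntegral_two_mul_cos_of_injOn measurableSet_Ioo, setLIntegral_two_mul_cos_of_injOn
    measurableSet_Ioo, two_mul]
  · intro x hx y hy hxy
    exact Real.injOn_cos ⟨hx.1.le, by linarith [hx.2]⟩ ⟨hy.1.le, by linarith [hy.2]⟩
      (by simpa using hxy)
  · ext y
    constructor
    · rintro ⟨φ, hφ, rfl⟩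
      have h1 := Real.cos_pos_of_mem_Ioo ⟨by linarith [hφ.1], hφ.2⟩
      have h2 : Real.cos φ < Real.cos 0 :=
        Real.cos_lt_cos_of_nonneg_of_le_pi_div_two le_rfl hφ.2.le hφ.1
      rw [Real.cos_zero] at h2
      constructor <;> simp only <;> linarith
    · intro hy
      refine ⟨Real.arccos (y / 2), ⟨Real.arccos_pos.2 (by linarith [hy.2]),
        Real.arccos_lt_pi_div_two.2 (by linarith [hy.1])⟩, ?_⟩
      simp only
      rw [Real.cos_arccos (by linarith [hy.1]) (by linarith [hy.2])]
      ring
  · intro φ hφ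
    exact (Real.sin_pos_of_pos_of_lt_pi hφ.1 (by linarith [hφ.2])).ne'
  · intro x hx y hy hxy
    have := Real.injOn_cos (x₁ := -x) ⟨by linarith [hx.2], by linarith [hx.1]⟩
      (x₂ := -y) ⟨by linarith [hy.2], by linarith [hy.1]⟩ (by simpa using hxy)
    linarith
  · ext y
    constructor
    · rintro ⟨φ, hφ, rfl⟩
      have h1 := Real.cos_pos_of_mem_Ioo ⟨hφ.1, by linarith [hφ.2]⟩
      have h2 : Real.cos (-φ) < Real.cos 0 :=
        Real.cos_lt_cos_of_nonneg_of_le_pi_div_two le_rfl (by linarith [hφ.1])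
          (by linarith [hφ.2])
      rw [Real.cos_zero, Real.cos_neg] at h2
      constructor <;> simp only <;> linarith
    · intro hy
      have h1 := Real.arccos_pos.2 (by linarith [hy.2] : y / 2 < 1)
      have h2 := Real.arccos_lt_pi_div_two.2 (by linarith [hy.1] : 0 < y / 2)
      refine ⟨-Real.arccos (y / 2), ⟨by linarith, by linarith⟩, ?_⟩
      simp only
      rw [Real.cos_neg, Real.cos_arccos (by linarith [hy.1]) (by linarith [hy.2])]
      ring
  · intro φ hφ
    exact (Real.sin_neg_of_neg_of_neg_pi_lt hφ.2 (by linarith [hφ.1])).ne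
  · exact Set.disjoint_left.2 fun x hx hx' => absurd hx.2 (not_le.2 hx'.1)

theorem lintegral_polar {F : ℂ → ENNReal} (hF : Measurable F) :
    ∫⁻ z, F z = ∫⁻ φ in Set.Ioo (-Real.pi) Real.pi, ∫⁻ r in Set.Ioi (0 : ℝ),
      ENNReal.ofReal r * F (r * (Real.cos φ + Real.sin φ * Complex.I)) := by
  rw [← Complex.lintegral_comp_polarCoord_symm, polarCoord_target, Measure.volume_eq_prod,
    ← Measure.prod_restrict, lintegral_prod_symm]
  · simp [Complex.polarCoord_symm_apply]
  · refine Measurable.aemeasurable ?_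
    simp only [Complex.polarCoord_symm_apply, smul_eq_mul]
    exact (by fun_prop : Measurable fun p : ℝ × ℝ => ENNReal.ofReal p.1).mul
      (hF.comp (by fun_prop))

theorem normSq_polar (r φ : ℝ) :
    Complex.normSq (r * (Real.cos φ + Real.sin φ * Complex.I)) = r ^ 2 := by
  rw [Complex.normSq_apply]
  simp only [Complex.mul_re, Complex.mul_im, Complex.add_re, Complex.add_im, Complex.ofReal_re,
    Complex.ofReal_im, Complex.I_re, Complex.I_im]
  nlinarith [Real.sin_sq_add_cos_sq φ]

theorem norm_polar {r : ℝ} (hr : 0 ≤ r) (φ : ℝ) :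
    ‖(r : ℂ) * (Real.cos φ + Real.sin φ * Complex.I)‖ = r := by
  rw [← sq_eq_sq₀ (norm_nonneg _) hr, ← Complex.normSq_eq_norm_sq, normSq_polar]

/-- Polar coordinates centred at `1`: the ratio `(2 - 2 * re z) / ‖1 - z‖` is twice the cosine of
the angle, and the radial integral over a chord of the disc is a power of its length. -/
theorem exists_lintegral_ball_ratio (b : ℕ) :
    ∃ K : ENNReal, ∀ f : ℝ → ENNReal, Measurable f →
      ∫⁻ z in Metric.ball (0 : ℂ) 1, ENNReal.ofReal ((1 - ‖z‖ ^ 2) ^ b) *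
        f ((2 - 2 * z.re) / ‖1 - z‖) =
      K * ∫⁻ φ in Set.Ioo (-(Real.pi / 2)) (Real.pi / 2),
        ENNReal.ofReal ((2 * Real.cos φ) ^ (2 * (b + 1))) * f (2 * Real.cos φ) := by
  classical
  set Ψ : ℝ → ENNReal := (Set.Ioi 0).indicator fun t => ENNReal.ofReal (t ^ b) with hΨ
  have hΨm : Measurable Ψ := (by fun_prop : Measurable fun t : ℝ =>
    ENNReal.ofReal (t ^ b)).indicator measurableSet_Ioi
  set f₀ : ℝ → ENNReal := (Set.Ioi 0).indicator
    fun s => ENNReal.ofReal s * Ψ (s * (1 - s)) with hf₀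
  have hf₀m : Measurable f₀ := ((by fun_prop : Measurable fun s : ℝ => ENNReal.ofReal s).mul
    (hΨm.comp (by fun_prop))).indicator measurableSet_Ioi
  refine ⟨∫⁻ s, f₀ s, fun f hf => ?_⟩
  have hGm : Measurable fun z : ℂ => Ψ (1 - ‖z‖ ^ 2) * f ((2 - 2 * z.re) / ‖1 - z‖) :=
    (hΨm.comp (by fun_prop)).mul (hf.comp (by fun_prop))
  have h1 : ∫⁻ z in Metric.ball (0 : ℂ) 1, ENNReal.ofReal ((1 - ‖z‖ ^ 2) ^ b) *
        f ((2 - 2 * z.re) / ‖1 - z‖) =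
      ∫⁻ w : ℂ, Ψ (1 - ‖1 - w‖ ^ 2) * f ((2 - 2 * (1 - w).re) / ‖1 - (1 - w)‖) := by
    rw [lintegral_sub_left_eq_self
      (fun z : ℂ => Ψ (1 - ‖z‖ ^ 2) * f ((2 - 2 * z.re) / ‖1 - z‖)) 1,
      ← lintegral_indicator Metric.isOpen_ball.measurableSet]
    refine lintegral_congr fun z => ?_
    simp only [hΨ, Set.indicator_apply, mem_ball_zero_iff, Set.mem_Ioi, sub_pos,
      sq_lt_one_iff₀ (norm_nonneg z)]
    split_ifs <;> simp
  have hpolar : ∀ φ r : ℝ, 0 < r →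
      Ψ (1 - ‖1 - (r : ℂ) * (Real.cos φ + Real.sin φ * Complex.I)‖ ^ 2) *
        f ((2 - 2 * (1 - (r : ℂ) * (Real.cos φ + Real.sin φ * Complex.I)).re) /
          ‖1 - (1 - (r : ℂ) * (Real.cos φ + Real.sin φ * Complex.I))‖) =
      Ψ (r * (2 * Real.cos φ - r)) * f (2 * Real.cos φ) := by
    intro φ r hr
    set w := (r : ℂ) * (Real.cos φ + Real.sin φ * Complex.I) with hw
    have hre : w.re = r * Real.cos φ := by
      simp only [hw, Complex.mul_re, Complex.add_re, Complex.add_im, Complex.ofReal_re,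
        Complex.ofReal_im, Complex.I_re, Complex.I_im, Complex.mul_im]
      ring
    have hn : ‖w‖ = r := norm_polar hr.le φ
    have h2 : ‖1 - w‖ ^ 2 = 1 - 2 * w.re + ‖w‖ ^ 2 := by
      rw [← Complex.normSq_eq_norm_sq, ← Complex.normSq_eq_norm_sq, Complex.normSq_sub]
      simp
      ring
    rw [sub_sub_cancel, hn, h2, hn, Complex.sub_re, hre, Complex.one_re]
    congr 2
    · ring
    · field_simp
      ring
  have hinner : ∀ φ : ℝ, ∫⁻ r in Set.Ioi (0 : ℝ), ENNReal.ofReal r *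
      (Ψ (r * (2 * Real.cos φ - r)) * f (2 * Real.cos φ)) =
      (∫⁻ s, f₀ s) * ((Set.Ioi 0).indicator (fun m : ℝ =>
        ENNReal.ofReal (m ^ (2 * (b + 1))) * f m) (2 * Real.cos φ)) := by
    intro φ
    set m := 2 * Real.cos φ
    by_cases hm : 0 < m
    · have hsc := lintegral_inv_smul volume hf₀m hm
      rw [Module.finrank_self, pow_one] at hsc
      have hp : ENNReal.ofReal (m ^ (2 * (b + 1))) =
          ENNReal.ofReal (m ^ (2 * b + 1)) * ENNReal.ofReal m := by
        rw [← ENNReal.ofReal_mul (by positivity)]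
        ring_nf
      rw [Set.indicator_of_mem (Set.mem_Ioi.2 hm), hp]
      calc _ = ∫⁻ r, (ENNReal.ofReal (m ^ (2 * b + 1)) * f m) * f₀ (m⁻¹ • r) := by
            rw [← lintegral_indicator measurableSet_Ioi]
            refine lintegral_congr fun r => ?_
            have h3 : 0 < m⁻¹ * r ↔ 0 < r := by
              rw [mul_pos_iff_of_pos_left (inv_pos.2 hm)]
            have h4 : r * (m - r) = m ^ 2 * (m⁻¹ * r * (1 - m⁻¹ * r)) := by
              field_simp
            simp only [hf₀, Set.indicator_apply, Set.mem_Ioi, smul_eq_mul, h3]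
            by_cases hr : 0 < r
            · simp only [hr, if_true, hΨ, Set.indicator_apply, Set.mem_Ioi]
              have h5 : 0 < r * (m - r) ↔ 0 < m⁻¹ * r * (1 - m⁻¹ * r) := by
                rw [h4, mul_pos_iff_of_pos_left (by positivity)]
              simp only [h5]
              split_ifs with h6
              · have h7 : ENNReal.ofReal r * ENNReal.ofReal ((r * (m - r)) ^ b) =
                    ENNReal.ofReal (m ^ (2 * b + 1)) * (ENNReal.ofReal (m⁻¹ * r) *
                      ENNReal.ofReal ((m⁻¹ * r * (1 - m⁻¹ * r)) ^ b)) := by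
                  rw [← ENNReal.ofReal_mul hr.le, ← ENNReal.ofReal_mul (by positivity),
                    ← ENNReal.ofReal_mul (by positivity)]
                  congr 1
                  rw [h4, mul_pow]
                  field_simp
                  ring_nf
                rw [← mul_assoc, h7]
                ring
              · simp
            · simp [hr]
        _ = _ := by
            rw [lintegral_const_mul _ (f := fun r => f₀ (m⁻¹ • r)) (hf₀m.comp (by fun_prop)), hsc]
            ring
    · rw [Set.indicator_of_notMem (by simpa using hm), mul_zero,
        ← lintegral_zero (μ := volume.restrict (Set.Ioi (0 : ℝ)))]
      refine setLIntegral_congr_fun measurableSet_Ioi fun r hr => ?_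
      have hr' : (0 : ℝ) < r := hr
      have : Ψ (r * (m - r)) = 0 := Set.indicator_of_notMem (by
        rw [Set.mem_Ioi, not_lt]
        nlinarith) _
      simp [this]
  have hH : Measurable fun m : ℝ => (Set.Ioi (0 : ℝ)).indicator
      (fun m : ℝ => ENNReal.ofReal (m ^ (2 * (b + 1))) * f m) m :=
    ((by fun_prop : Measurable fun m : ℝ => ENNReal.ofReal (m ^ (2 * (b + 1)))).mul
      hf).indicator measurableSet_Ioi
  rw [h1, lintegral_polar (F := fun w : ℂ => Ψ (1 - ‖1 - w‖ ^ 2) *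
    f ((2 - 2 * (1 - w).re) / ‖1 - (1 - w)‖))
    (hGm.comp (by fun_prop : Measurable fun w : ℂ => 1 - w))]
  have h2 : ∀ φ : ℝ, ∫⁻ r in Set.Ioi (0 : ℝ), ENNReal.ofReal r *
      (Ψ (1 - ‖1 - (r : ℂ) * (Real.cos φ + Real.sin φ * Complex.I)‖ ^ 2) *
        f ((2 - 2 * (1 - (r : ℂ) * (Real.cos φ + Real.sin φ * Complex.I)).re) /
          ‖1 - (1 - (r : ℂ) * (Real.cos φ + Real.sin φ * Complex.I))‖)) = _ := fun φ =>
    (setLIntegral_congr_fun measurableSet_Ioi fun r hr => by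
      simp only [hpolar φ r hr]).trans (hinner φ)
  rw [lintegral_congr h2, lintegral_const_mul _ (f := fun φ => (Set.Ioi (0 : ℝ)).indicator
    (fun m : ℝ => ENNReal.ofReal (m ^ (2 * (b + 1))) * f m) (2 * Real.cos φ))
    (hH.comp (by fun_prop : Measurable fun φ : ℝ => 2 * Real.cos φ))]
  congr 1
  rw [← lintegral_indicator measurableSet_Ioo, ← lintegral_indicator measurableSet_Ioo]
  refine lintegral_congr fun φ => ?_
  simp only [Set.indicator_apply, Set.mem_Ioi]
  have hpi := Real.pi_pos
  by_cases h3 : φ ∈ Set.Ioo (-(Real.pi / 2)) (Real.pi / 2)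
  · have h4 := Real.cos_pos_of_mem_Ioo h3
    rw [if_pos ⟨by linarith [h3.1], by linarith [h3.2]⟩, if_pos (by linarith), if_pos h3]
  · rw [if_neg h3]
    split_ifs with h5 h6
    · exfalso
      have hc : Real.cos |φ| ≤ 0 := by
        refine Real.cos_nonpos_of_pi_div_two_le_of_le ?_ ?_
        · by_contra h7
          exact h3 (abs_lt.1 (not_le.1 h7))
        · have := abs_lt.2 h5
          linarith
      rw [Real.cos_abs] at hc
      linarith
    all_goals rfl

/-- The analogue of `exists_lintegral_ball_ratio` on the unit circle, where the ratio is the chord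
length `‖1 - z‖`. -/
theorem exists_lintegral_circle_ratio :
    ∃ K : ENNReal, ∀ f : ℝ → ENNReal, Measurable f →
      ∫⁻ z in Metric.ball (0 : ℂ) 1, f ((2 - 2 * (‖z‖⁻¹ • z).re) / ‖1 - ‖z‖⁻¹ • z‖) =
      K * ∫⁻ φ in Set.Ioo (-(Real.pi / 2)) (Real.pi / 2), f (2 * Real.cos φ) := by
  classical
  refine ⟨(∫⁻ r in Set.Ioi (0 : ℝ), ENNReal.ofReal r * (Set.Iio (1 : ℝ)).indicator 1 r) * 2,
    fun f hf => ?_⟩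
  set G : ℂ → ENNReal := fun z => (Set.Iio (1 : ℝ)).indicator 1 ‖z‖ *
    f ((2 - 2 * (‖z‖⁻¹ • z).re) / ‖1 - ‖z‖⁻¹ • z‖) with hG
  have hI : Measurable ((Set.Iio (1 : ℝ)).indicator (1 : ℝ → ENNReal)) :=
    measurable_one.indicator measurableSet_Iio
  have hGm : Measurable G := (hI.comp (by fun_prop)).mul (hf.comp (by fun_prop))
  -- The reflection `z ↦ -z` moves the singular direction `z = 1` to the cut `φ = ± π`.
  have h1 : ∫⁻ z in Metric.ball (0 : ℂ) 1, f ((2 - 2 * (‖z‖⁻¹ • z).re) / ‖1 - ‖z‖⁻¹ • z‖) =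
      ∫⁻ z, G (0 - z) := by
    rw [lintegral_sub_left_eq_self, ← lintegral_indicator Metric.isOpen_ball.measurableSet]
    refine lintegral_congr fun z => ?_
    simp only [hG, Set.indicator_apply, mem_ball_zero_iff, Set.mem_Iio]
    split_ifs <;> simp
  have hpolar : ∀ φ ∈ Set.Ioo (-Real.pi) Real.pi, ∀ r : ℝ, 0 < r →
      G (0 - (r : ℂ) * (Real.cos φ + Real.sin φ * Complex.I)) =
      (Set.Iio (1 : ℝ)).indicator 1 r * f (2 * Real.cos (φ / 2)) := by
    intro φ hφ r hr
    have hc : 0 < Real.cos (φ / 2) :=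
      Real.cos_pos_of_mem_Ioo ⟨by linarith [hφ.1], by linarith [hφ.2]⟩
    have h2 : Real.cos φ = 2 * Real.cos (φ / 2) ^ 2 - 1 := by
      rw [← Real.cos_two_mul]
      congr 1
      ring
    have h3 : ‖1 + ((Real.cos φ : ℂ) + Real.sin φ * Complex.I)‖ = 2 * Real.cos (φ / 2) := by
      rw [← sq_eq_sq₀ (norm_nonneg _) (by positivity), ← Complex.normSq_eq_norm_sq,
        Complex.normSq_apply]
      simp only [Complex.mul_re, Complex.mul_im, Complex.add_re, Complex.add_im,
        Complex.ofReal_re, Complex.ofReal_im, Complex.I_re, Complex.I_im, Complex.one_re,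
        Complex.one_im]
      nlinarith [Real.sin_sq_add_cos_sq φ]
    have h4 : r⁻¹ • (0 - (r : ℂ) * (Real.cos φ + Real.sin φ * Complex.I)) =
        -((Real.cos φ : ℂ) + Real.sin φ * Complex.I) := by
      rw [zero_sub, smul_neg, Complex.real_smul, ← mul_assoc, ← Complex.ofReal_mul,
        inv_mul_cancel₀ hr.ne', Complex.ofReal_one, one_mul]
    have h5 : ‖0 - (r : ℂ) * (Real.cos φ + Real.sin φ * Complex.I)‖ = r := by
      rw [zero_sub, norm_neg, norm_polar hr.le]
    simp only [hG]
    rw [h5, h4, sub_neg_eq_add, h3]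
    congr 2
    simp only [Complex.neg_re, Complex.add_re, Complex.mul_re, Complex.ofReal_re,
      Complex.ofReal_im, Complex.I_re, Complex.I_im, h2]
    field_simp
    ring
  have hsc := lintegral_inv_smul volume (f := (Set.Ioo (-(Real.pi / 2)) (Real.pi / 2)).indicator
    fun φ : ℝ => f (2 * Real.cos φ)) ((hf.comp (by fun_prop)).indicator measurableSet_Ioo)
    (two_pos : (0 : ℝ) < 2)
  rw [Module.finrank_self, pow_one, lintegral_indicator measurableSet_Ioo] at hsc
  have h6 : ∀ φ ∈ Set.Ioo (-Real.pi) Real.pi, ∫⁻ r in Set.Ioi (0 : ℝ), ENNReal.ofReal r *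
      G (0 - (r : ℂ) * (Real.cos φ + Real.sin φ * Complex.I)) =
      (∫⁻ r in Set.Ioi (0 : ℝ), ENNReal.ofReal r * (Set.Iio (1 : ℝ)).indicator 1 r) *
        f (2 * Real.cos (φ / 2)) := by
    intro φ hφ
    rw [← lintegral_mul_const _ (f := fun r : ℝ => ENNReal.ofReal r *
      (Set.Iio (1 : ℝ)).indicator 1 r) (Measurable.mul (by fun_prop) hI)]
    refine setLIntegral_congr_fun measurableSet_Ioi fun r hr => ?_
    simp only [hpolar φ hφ r hr]
    ring
  rw [h1, lintegral_polar (F := fun w : ℂ => G (0 - w))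
    (hGm.comp (by fun_prop : Measurable fun w : ℂ => 0 - w))]
  rw [setLIntegral_congr_fun measurableSet_Ioo h6, lintegral_const_mul _
    (f := fun φ : ℝ => f (2 * Real.cos (φ / 2))) (hf.comp (by fun_prop)), mul_assoc]
  congr 1
  rw [ENNReal.ofReal_ofNat] at hsc
  rw [← hsc, ← lintegral_indicator measurableSet_Ioo]
  refine lintegral_congr fun φ => ?_
  have h7 : (2 : ℝ)⁻¹ • φ = φ / 2 := by rw [smul_eq_mul]; ring
  have h8 : φ / 2 ∈ Set.Ioo (-(Real.pi / 2)) (Real.pi / 2) ↔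
      φ ∈ Set.Ioo (-Real.pi) Real.pi := by
    constructor <;> rintro ⟨h, h'⟩ <;> constructor <;> linarith
  rw [h7]
  simp only [Set.indicator_apply, h8]

/-- The law of `2 * cos φ` with `φ` of density proportional to `(cos φ) ^ (2 * p)`, which has the
density `y ^ (2 * p) / √(4 - y ^ 2)` on `(0, 2)` up to normalization. -/
theorem hasPowerDensity_map_ratio {n p : ℕ} (k : Fin n) (h : n - k = p + 1) :
    HasPowerDensity (2 * p) ((uniformTailSphere n k).map fun x =>
      (2 - 2 * (inner ℂ (tailBasisVector k) x.1).re) / ‖1 - inner ℂ (tailBasisVector k) x.1‖) := by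
  classical
  have hlaw : ∃ C : ENNReal, ∀ f : ℝ → ENNReal, Measurable f →
      ∫⁻ x, f ((2 - 2 * (inner ℂ (tailBasisVector k) x.1).re) /
        ‖1 - inner ℂ (tailBasisVector k) x.1‖) ∂(uniformTailSphere n k) =
      C * ∫⁻ φ in Set.Ioo (-(Real.pi / 2)) (Real.pi / 2),
        ENNReal.ofReal ((2 * Real.cos φ) ^ (2 * p)) * f (2 * Real.cos φ) := by
    rcases p with _ | b
    · obtain ⟨C, hC⟩ := exists_lintegral_coord_uniformTailSphere_one k h
      obtain ⟨K, hK⟩ := exists_lintegral_circle_ratio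
      refine ⟨C * K, fun f hf => ?_⟩
      rw [hC (fun c => f ((2 - 2 * c.re) / ‖1 - c‖)) (hf.comp (by fun_prop)), hK f hf]
      simp [mul_assoc]
    · obtain ⟨C, hC⟩ := exists_lintegral_coord_uniformTailSphere k h
      obtain ⟨K, hK⟩ := exists_lintegral_ball_ratio b
      refine ⟨C * K, fun f hf => ?_⟩
      rw [hC (fun c => f ((2 - 2 * c.re) / ‖1 - c‖)) (hf.comp (by fun_prop)), hK f hf, mul_assoc]
  obtain ⟨C, hC⟩ := hlaw
  set μ := (uniformTailSphere n k).map fun x => (2 - 2 * (inner ℂ (tailBasisVector k) x.1).re) /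
    ‖1 - inner ℂ (tailBasisVector k) x.1‖ with hμ
  have hm : Measurable fun x : TailSphere n k =>
      (2 - 2 * (inner ℂ (tailBasisVector k) x.1).re) / ‖1 - inner ℂ (tailBasisVector k) x.1‖ := by
    have hc : Measurable fun x : TailSphere n k => inner ℂ (tailBasisVector k) x.1 := by
      refine Continuous.measurable ?_
      fun_prop
    exact (by fun_prop : Measurable fun c : ℂ => (2 - 2 * c.re) / ‖1 - c‖).comp hc
  have hprob : IsProbabilityMeasure μ := Measure.isProbabilityMeasure_map hm.aemeasurable
  set w : ℝ → ℝ := (Set.Ioo 0 2).indicator fun y => (√(4 - y ^ 2))⁻¹ * y ^ (2 * p) with hw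
  have hwm : Measurable w := (by fun_prop : Measurable fun y : ℝ =>
    (√(4 - y ^ 2))⁻¹ * y ^ (2 * p)).indicator measurableSet_Ioo
  have hw0 : ∀ y, 0 ≤ w y := fun y => Set.indicator_nonneg (fun y hy => by
    have := hy.1
    positivity) y
  have hμw : μ = (C * 2) • volume.withDensity fun y => ENNReal.ofReal (w y) := by
    refine Measure.ext_of_lintegral _ fun f hf => ?_
    rw [hμ, lintegral_map hf hm, hC f hf, setLIntegral_two_mul_cos
      (fun y => ENNReal.ofReal (y ^ (2 * p)) * f y), lintegral_smul_measure,
      lintegral_withDensity_eq_lintegral_mul _ (by fun_prop) hf, smul_eq_mul, mul_assoc,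
      ← lintegral_indicator measurableSet_Ioo]
    congr 2
    refine lintegral_congr fun y => ?_
    simp only [Pi.mul_apply, hw, Set.indicator_apply]
    split_ifs
    · rw [ENNReal.ofReal_mul (by positivity), mul_assoc]
    · simp
  set c := (volume.withDensity fun y => ENNReal.ofReal (w y)) Set.univ with hc
  have hμc := eq_inv_smul_of_isProbabilityMeasure hμw
  have h1 : c⁻¹ * c = 1 := by
    have := measure_univ (μ := μ)
    rwa [hμc, Measure.smul_apply, smul_eq_mul] at this
  have hc0 : c ≠ 0 := fun h0 => by simp [h0] at h1
  have hct : c ≠ ⊤ := fun h0 => by simp [h0] at h1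
  have hcpos : 0 < c.toReal⁻¹ := inv_pos.2 (ENNReal.toReal_pos hc0 hct)
  refine ⟨c.toReal⁻¹ / 2, by positivity, fun y => c.toReal⁻¹ * w y, by fun_prop,
    fun y => mul_nonneg hcpos.le (hw0 y), ?_, ?_⟩
  · rw [hμc, ← withDensity_smul _ (by fun_prop)]
    congr 1
    funext y
    rw [Pi.smul_apply, smul_eq_mul, ENNReal.ofReal_mul hcpos.le, ENNReal.ofReal_inv_of_pos
      (ENNReal.toReal_pos hc0 hct), ENNReal.ofReal_toReal hct]
  · rw [Asymptotics.isEquivalent_iff_exists_eq_mul]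
    refine ⟨fun y => 2 * (√(4 - y ^ 2))⁻¹, ?_, ?_⟩
    · have hcont : ContinuousAt (fun y : ℝ => 2 * (√(4 - y ^ 2))⁻¹) 0 := by
        refine continuousAt_const.mul (ContinuousAt.inv₀ (by fun_prop) ?_)
        norm_num
      have h4 : √(4 : ℝ) = 2 := by
        rw [show (4 : ℝ) = 2 ^ 2 by norm_num, Real.sqrt_sq (by norm_num)]
      have := hcont.tendsto.mono_left (nhdsWithin_le_nhds (s := Set.Ioi 0))
      simpa [h4] using this
    · filter_upwards [Ioo_mem_nhdsGT (two_pos : (0 : ℝ) < 2)] with y hy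
      simp only [hw, Set.indicator_of_mem hy, Pi.mul_apply]
      ring

/-! ### Products of independent variables -/

open Filter Topology in
theorem eventually_le_two_mul_of_isEquivalent {m : ℕ} {h : ℝ → ℝ} {d : ℝ} (hd : 0 < d)
    (hh : Asymptotics.IsEquivalent (𝓝[>] 0) h (fun ε => d * ε ^ m)) :
    ∀ᶠ y in 𝓝[>] (0 : ℝ), h y ≤ 2 * d * y ^ m := by
  obtain ⟨φ, hφ, heq⟩ := Asymptotics.isEquivalent_iff_exists_eq_mul.1 hh
  filter_upwards [heq, hφ.eventually (gt_mem_nhds (by norm_num : (1 : ℝ) < 2)),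
    self_mem_nhdsWithin] with y h1 h2 h3
  have h4 : 0 < d * y ^ m := mul_pos hd (pow_pos h3 _)
  rw [h1, Pi.mul_apply]
  nlinarith

open Filter Topology in
theorem tendsto_div_pow_of_isEquivalent {m : ℕ} {h : ℝ → ℝ} {d : ℝ}
    (hh : Asymptotics.IsEquivalent (𝓝[>] 0) h (fun ε => d * ε ^ m)) :
    Tendsto (fun y => h y / y ^ m) (𝓝[>] 0) (𝓝 d) := by
  obtain ⟨φ, hφ, heq⟩ := Asymptotics.isEquivalent_iff_exists_eq_mul.1 hh
  have := hφ.mul_const d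
  rw [one_mul] at this
  refine this.congr' ?_
  filter_upwards [heq, self_mem_nhdsWithin] with y h1 h2
  have h3 : y ^ m ≠ 0 := pow_ne_zero _ (ne_of_gt h2)
  rw [h1, Pi.mul_apply]
  field_simp

open Filter Topology in
theorem isEquivalent_of_tendsto_div_pow {m : ℕ} {h : ℝ → ℝ} {d : ℝ} (hd : 0 < d)
    (hh : Tendsto (fun y => h y / y ^ m) (𝓝[>] 0) (𝓝 d)) :
    Asymptotics.IsEquivalent (𝓝[>] 0) h (fun ε => d * ε ^ m) := by
  rw [Asymptotics.isEquivalent_iff_exists_eq_mul]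
  refine ⟨fun y => h y / y ^ m / d, ?_, ?_⟩
  · simpa [hd.ne'] using hh.div_const d
  · filter_upwards [self_mem_nhdsWithin] with y h2
    have h3 : y ^ m ≠ 0 := pow_ne_zero _ (ne_of_gt h2)
    rw [Pi.mul_apply]
    have := hd.ne'
    field_simp

/-- If `y` has density `h`, then `w * y` has density `w⁻¹ * h (ε / w)` at `ε`. -/
theorem lintegral_mul_comp_mul {h : ℝ → ℝ} (hh : Measurable h) {f : ℝ → ENNReal}
    (hf : Measurable f) {w : ℝ} (hw : 0 < w) :
    ∫⁻ y, ENNReal.ofReal (h y) * f (w * y) =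
      ∫⁻ ε, ENNReal.ofReal (w⁻¹ * h (ε / w)) * f ε := by
  have h1 := lintegral_inv_smul volume (f := fun y => ENNReal.ofReal (h y) * f (w * y))
    (by fun_prop) hw
  rw [Module.finrank_self, pow_one] at h1
  have h2 : ENNReal.ofReal w⁻¹ * ENNReal.ofReal w = 1 := by
    rw [← ENNReal.ofReal_mul (inv_nonneg.2 hw.le), inv_mul_cancel₀ hw.ne', ENNReal.ofReal_one]
  rw [← one_mul (∫⁻ y, ENNReal.ofReal (h y) * f (w * y)), ← h2, mul_assoc, ← h1,
    ← lintegral_const_mul _ (by fun_prop)]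
  refine lintegral_congr fun x => ?_
  rw [smul_eq_mul, mul_inv_cancel_left₀ hw.ne', ENNReal.ofReal_mul (inv_nonneg.2 hw.le),
    div_eq_inv_mul, mul_assoc]

theorem HasPowerDensity.map_const_mul {m : ℕ} {μ : Measure ℝ} (hμ : HasPowerDensity m μ)
    {c : ℝ} (hc : 0 < c) : HasPowerDensity m (μ.map fun y => c * y) := by
  obtain ⟨d, hd, h, hm, h0, rfl, hh⟩ := hμ
  refine ⟨c⁻¹ ^ (m + 1) * d, by positivity, fun ε => c⁻¹ * h (ε / c), by fun_prop,
    fun x => mul_nonneg (inv_nonneg.2 hc.le) (h0 _), ?_, ?_⟩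
  · refine Measure.ext_of_lintegral _ fun f hf => ?_
    rw [lintegral_map hf (by fun_prop), lintegral_withDensity_eq_lintegral_mul _ (by fun_prop)
      (by fun_prop), lintegral_withDensity_eq_lintegral_mul _ (by fun_prop) hf]
    exact lintegral_mul_comp_mul hm hf hc
  · refine isEquivalent_of_tendsto_div_pow (by positivity) ?_
    have ht : Filter.Tendsto (fun ε : ℝ => ε / c) (nhdsWithin 0 (Set.Ioi 0))
        (nhdsWithin 0 (Set.Ioi 0)) := by
      refine tendsto_nhdsWithin_iff.2 ⟨?_, ?_⟩
      · have : Filter.Tendsto (fun ε : ℝ => ε / c) (nhds 0) (nhds (0 / c)) :=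
          Filter.tendsto_id.div_const c
        rw [zero_div] at this
        exact this.mono_left nhdsWithin_le_nhds
      · filter_upwards [self_mem_nhdsWithin] with y hy
        exact div_pos hy hc
    have := ((tendsto_div_pow_of_isEquivalent hh).comp ht).const_mul (c⁻¹ ^ (m + 1))
    refine this.congr fun ε => ?_
    simp only [Function.comp_apply, div_pow, pow_succ, inv_pow]
    field_simp

theorem setLIntegral_Ioi_comp_div (G : ℝ → ENNReal) {ε : ℝ} (hε : 0 < ε) :
    ∫⁻ w in Set.Ioi 0, G w = ∫⁻ y in Set.Ioi 0, ENNReal.ofReal (ε / y ^ 2) * G (ε / y) := by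
  have himage : (fun y : ℝ => ε / y) '' Set.Ioi 0 = Set.Ioi 0 := by
    ext w
    constructor
    · rintro ⟨y, hy, rfl⟩
      exact div_pos hε hy
    · intro hw
      refine ⟨ε / w, div_pos hε hw, ?_⟩
      have : w ≠ 0 := ne_of_gt hw
      field_simp
  have hd : ∀ y ∈ Set.Ioi (0 : ℝ),
      HasDerivWithinAt (fun y : ℝ => ε / y) (-(ε / y ^ 2)) (Set.Ioi 0) y := by
    intro y hy
    have hy' : y ≠ 0 := ne_of_gt hy
    refine HasDerivAt.hasDerivWithinAt ?_
    have := (hasDerivAt_inv hy').const_mul ε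
    simpa [div_eq_mul_inv] using this
  have hinj : Set.InjOn (fun y : ℝ => ε / y) (Set.Ioi 0) := by
    intro x hx y hy hxy
    have hx' : x ≠ 0 := ne_of_gt hx
    have hy' : y ≠ 0 := ne_of_gt hy
    simp only at hxy
    field_simp at hxy
    exact hxy.symm
  conv_lhs => rw [← himage]
  rw [lintegral_image_eq_lintegral_abs_deriv_mul measurableSet_Ioi hd hinj]
  refine setLIntegral_congr_fun measurableSet_Ioi fun y hy => ?_
  have hy' : (0 : ℝ) < y := hy
  rw [abs_neg, abs_of_pos (by positivity)]

/-- The measure `K * t ^ m` on the positive half-line. -/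
noncomputable def powerMeasure (K : ENNReal) (m : ℕ) : Measure ℝ :=
  K • (volume.restrict (Set.Ioi 0)).withDensity fun t => ENNReal.ofReal (t ^ m)

theorem lintegral_powerMeasure (K : ENNReal) (m : ℕ) {f : ℝ → ENNReal} (hf : Measurable f) :
    ∫⁻ t, f t ∂(powerMeasure K m) =
      K * ∫⁻ t in Set.Ioi 0, ENNReal.ofReal (t ^ m) * f t := by
  rw [powerMeasure, lintegral_smul_measure, lintegral_withDensity_eq_lintegral_mul _
    (by fun_prop) hf, smul_eq_mul]
  rfl

theorem ae_pos_of_le_powerMeasure {ν : Measure ℝ} {K : ENNReal} {m : ℕ}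
    (hν : ν ≤ powerMeasure K m) : ∀ᵐ w ∂ν, 0 < w := by
  have h1 : ν ≪ volume.restrict (Set.Ioi (0 : ℝ)) :=
    (Measure.absolutelyContinuous_of_le hν).trans
      ((withDensity_absolutelyContinuous _ _).smul_left K)
  exact h1.ae_le (ae_restrict_mem measurableSet_Ioi)

theorem lintegral_inv_pow_ne_top {ν : Measure ℝ} [IsFiniteMeasure ν] {K : ENNReal} (hK : K ≠ ⊤)
    {m : ℕ} (hν : ν ≤ powerMeasure K m) : ∫⁻ w, ENNReal.ofReal (w⁻¹ ^ m) ∂ν ≠ ⊤ := by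
  set f : ℝ → ENNReal := (Set.Ioo 0 1).indicator fun w => ENNReal.ofReal (w⁻¹ ^ m) with hf
  have hfm : Measurable f := (by fun_prop : Measurable fun w : ℝ =>
    ENNReal.ofReal (w⁻¹ ^ m)).indicator measurableSet_Ioo
  have h1 : ∫⁻ w, ENNReal.ofReal (w⁻¹ ^ m) ∂ν ≤ ∫⁻ w, 1 + f w ∂ν := by
    refine lintegral_mono_ae ?_
    filter_upwards [ae_pos_of_le_powerMeasure hν] with w hw
    by_cases h : w < 1
    · rw [hf, Set.indicator_of_mem (Set.mem_Ioo.2 ⟨hw, h⟩)]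
      exact le_add_self
    · refine le_add_right ?_
      rw [ENNReal.ofReal_le_one]
      exact pow_le_one₀ (inv_nonneg.2 hw.le) (inv_le_one_of_one_le₀ (not_lt.1 h))
  have h2 : ∫⁻ w, f w ∂ν ≤ K := by
    refine (lintegral_mono' hν le_rfl).trans ?_
    rw [lintegral_powerMeasure _ _ hfm]
    have : ∀ t : ℝ, ENNReal.ofReal (t ^ m) * f t = (Set.Ioo (0 : ℝ) 1).indicator 1 t := by
      intro t
      by_cases ht : t ∈ Set.Ioo (0 : ℝ) 1
      · rw [hf, Set.indicator_of_mem ht, Set.indicator_of_mem ht,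
          ← ENNReal.ofReal_mul (pow_nonneg ht.1.le _), ← mul_pow, mul_inv_cancel₀ ht.1.ne']
        simp
      · rw [hf, Set.indicator_of_notMem ht, Set.indicator_of_notMem ht, mul_zero]
    rw [lintegral_congr this, lintegral_indicator_one measurableSet_Ioo]
    refine (mul_le_mul_right ((Measure.restrict_apply_le _ _).trans ?_) K).trans (mul_one K).le
    simp
  rw [lintegral_add_left measurable_const] at h1
  refine ne_top_of_le_ne_top ?_ h1
  refine ENNReal.add_ne_top.2 ⟨?_, ne_top_of_le_ne_top hK h2⟩
  simp

/-- Where `ε / w` stays above `δ`, the bound on `ν` near `0` gains one more power of `ε`. -/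
theorem lintegral_inv_mul_comp_div_le {ν : Measure ℝ} {K : ENNReal} {m : ℕ}
    (hν : ν ≤ powerMeasure K (m + 1)) {h : ℝ → ℝ} (hm : Measurable h) (h0 : ∀ x, 0 ≤ h x)
    {δ ε : ℝ} (hδ : 0 < δ) (hε : 0 < ε) :
    ∫⁻ w, ENNReal.ofReal (w⁻¹ * (Set.Ici δ).indicator h (ε / w)) ∂ν ≤
      K * (ENNReal.ofReal (ε ^ (m + 1) * δ⁻¹ ^ (m + 2)) * ∫⁻ y, ENNReal.ofReal (h y)) := by
  have hm2 : Measurable ((Set.Ici δ).indicator h) := hm.indicator measurableSet_Ici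
  refine (lintegral_mono' hν le_rfl).trans ?_
  rw [lintegral_powerMeasure _ _ (by fun_prop), setLIntegral_Ioi_comp_div _ hε,
    ← lintegral_const_mul (ENNReal.ofReal (ε ^ (m + 1) * δ⁻¹ ^ (m + 2))) (by fun_prop)]
  refine mul_le_mul_right ?_ K
  refine (setLIntegral_mono' measurableSet_Ioi fun y hy => ?_).trans
    (setLIntegral_le_lintegral (Set.Ioi 0) _)
  have hy' : (0 : ℝ) < y := hy
  rw [← ENNReal.ofReal_mul (by positivity), ← ENNReal.ofReal_mul (by positivity),
    ← ENNReal.ofReal_mul (by positivity)]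
  refine ENNReal.ofReal_le_ofReal ?_
  have h1 : ε / (ε / y) = y := by field_simp
  rw [h1]
  by_cases hyd : δ ≤ y
  · rw [Set.indicator_of_mem (Set.mem_Ici.2 hyd)]
    have h2 : ε / y ^ 2 * ((ε / y) ^ (m + 1) * ((ε / y)⁻¹ * h y)) =
        ε ^ (m + 1) * y⁻¹ ^ (m + 2) * h y := by
      rw [pow_succ (ε / y), div_pow, inv_pow]
      field_simp
      ring
    rw [h2]
    have h3 : y⁻¹ ≤ δ⁻¹ := inv_anti₀ hδ hyd
    have := h0 y
    gcongr
  · rw [Set.indicator_of_notMem (by simpa using hyd)]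
    have := h0 y
    simp only [mul_zero]
    positivity

open Filter Topology in
/-- The density at `ε` of a product of independent variables, divided by `ε ^ m`. The density `h`
may be unbounded away from `0`, so it is cut at a point `δ` below which it is at most
`2 * d * y ^ m`: dominated convergence applies below `δ`, and the part above `δ` is of lower
order because of the bound on `ν`. -/
theorem tendsto_lintegral_inv_mul_comp_div {ν : Measure ℝ} [IsFiniteMeasure ν] {K : ENNReal}
    (hK : K ≠ ⊤) {m : ℕ} (hν : ν ≤ powerMeasure K (m + 1)) {h : ℝ → ℝ} (hm : Measurable h)
    (h0 : ∀ x, 0 ≤ h x) (hint : ∫⁻ y, ENNReal.ofReal (h y) ≠ ⊤) {d : ℝ} (hd : 0 < d)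
    (hh : Asymptotics.IsEquivalent (𝓝[>] 0) h (fun ε => d * ε ^ m)) :
    Tendsto (fun ε => ENNReal.ofReal (ε ^ m)⁻¹ *
      ∫⁻ w, ENNReal.ofReal (w⁻¹ * h (ε / w)) ∂ν) (𝓝[>] 0)
      (𝓝 (∫⁻ w, ENNReal.ofReal (d * w⁻¹ ^ (m + 1)) ∂ν)) := by
  obtain ⟨δ, hδ, hbound⟩ := mem_nhdsGT_iff_exists_Ioo_subset.1
    (eventually_le_two_mul_of_isEquivalent hd hh)
  have hδ' : (0 : ℝ) < δ := hδ
  have hm1 : Measurable ((Set.Iio δ).indicator h) := hm.indicator measurableSet_Iio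
  have hm2 : Measurable ((Set.Ici δ).indicator h) := hm.indicator measurableSet_Ici
  have hpos := ae_pos_of_le_powerMeasure hν
  have hsplit : ∀ᶠ ε in 𝓝[>] (0 : ℝ),
      (∫⁻ w, ENNReal.ofReal ((ε ^ m)⁻¹ * (w⁻¹ * (Set.Iio δ).indicator h (ε / w))) ∂ν) +
        ENNReal.ofReal (ε ^ m)⁻¹ *
          ∫⁻ w, ENNReal.ofReal (w⁻¹ * (Set.Ici δ).indicator h (ε / w)) ∂ν =
      ENNReal.ofReal (ε ^ m)⁻¹ * ∫⁻ w, ENNReal.ofReal (w⁻¹ * h (ε / w)) ∂ν := by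
    filter_upwards [self_mem_nhdsWithin] with ε hε
    have hε' : (0 : ℝ) < ε := hε
    have hi : 0 ≤ (ε ^ m)⁻¹ := by positivity
    rw [← lintegral_const_mul _ (by fun_prop), ← lintegral_const_mul _ (by fun_prop),
      ← lintegral_add_left (by fun_prop)]
    refine lintegral_congr_ae ?_
    filter_upwards [hpos] with w hw
    rw [← ENNReal.ofReal_mul hi, ← ENNReal.ofReal_mul hi]
    by_cases hc : ε / w < δ
    · rw [Set.indicator_of_mem (Set.mem_Iio.2 hc), Set.indicator_of_notMem (by simpa using hc)]
      simp
    · rw [Set.indicator_of_notMem (by simpa using hc),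
        Set.indicator_of_mem (Set.mem_Ici.2 (not_lt.1 hc))]
      simp
  have hmain : Tendsto (fun ε =>
      ∫⁻ w, ENNReal.ofReal ((ε ^ m)⁻¹ * (w⁻¹ * (Set.Iio δ).indicator h (ε / w))) ∂ν) (𝓝[>] 0)
      (𝓝 (∫⁻ w, ENNReal.ofReal (d * w⁻¹ ^ (m + 1)) ∂ν)) := by
    refine tendsto_lintegral_filter_of_dominated_convergence
      (fun w => ENNReal.ofReal (2 * d) * ENNReal.ofReal (w⁻¹ ^ (m + 1)))
      (Eventually.of_forall fun ε => by fun_prop) ?_ ?_ ?_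
    · filter_upwards [self_mem_nhdsWithin] with ε hε
      have hε' : (0 : ℝ) < ε := hε
      filter_upwards [hpos] with w hw
      rw [← ENNReal.ofReal_mul (by positivity)]
      refine ENNReal.ofReal_le_ofReal ?_
      by_cases hc : ε / w < δ
      · rw [Set.indicator_of_mem (Set.mem_Iio.2 hc)]
        have h1 : h (ε / w) ≤ 2 * d * (ε / w) ^ m := hbound ⟨by positivity, hc⟩
        have h2 : 2 * d * w⁻¹ ^ (m + 1) = (ε ^ m)⁻¹ * (w⁻¹ * (2 * d * (ε / w) ^ m)) := by
          rw [div_pow, pow_succ, inv_pow]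
          field_simp
        rw [h2]
        gcongr
      · rw [Set.indicator_of_notMem (by simpa using hc)]
        simp only [mul_zero]
        positivity
    · rw [lintegral_const_mul _ (by fun_prop)]
      exact ENNReal.mul_ne_top ENNReal.ofReal_ne_top (lintegral_inv_pow_ne_top hK hν)
    · filter_upwards [hpos] with w hw
      refine ENNReal.tendsto_ofReal ?_
      have ht0 : Tendsto (fun ε : ℝ => ε / w) (𝓝[>] 0) (𝓝 0) := by
        have : Tendsto (fun ε : ℝ => ε / w) (𝓝 0) (𝓝 (0 / w)) := tendsto_id.div_const w
        rw [zero_div] at this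
        exact this.mono_left nhdsWithin_le_nhds
      have ht : Tendsto (fun ε : ℝ => ε / w) (𝓝[>] 0) (𝓝[>] 0) := by
        refine tendsto_nhdsWithin_iff.2 ⟨ht0, ?_⟩
        filter_upwards [self_mem_nhdsWithin] with y hy
        exact div_pos hy hw
      have h1 := ((tendsto_div_pow_of_isEquivalent hh).comp ht).mul_const (w⁻¹ ^ (m + 1))
      refine h1.congr' ?_
      filter_upwards [ht0.eventually (gt_mem_nhds hδ'), self_mem_nhdsWithin] with ε h2 hε
      have hε' : (0 : ℝ) < ε := hε
      rw [Set.indicator_of_mem (Set.mem_Iio.2 h2), Function.comp_apply, div_pow, pow_succ,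
        inv_pow]
      field_simp
  have htail : Tendsto (fun ε => ENNReal.ofReal (ε ^ m)⁻¹ *
      ∫⁻ w, ENNReal.ofReal (w⁻¹ * (Set.Ici δ).indicator h (ε / w)) ∂ν) (𝓝[>] 0) (𝓝 0) := by
    have hconst : K * (ENNReal.ofReal (δ⁻¹ ^ (m + 2)) * ∫⁻ y, ENNReal.ofReal (h y)) ≠ ⊤ :=
      ENNReal.mul_ne_top hK (ENNReal.mul_ne_top ENNReal.ofReal_ne_top hint)
    have hlim : Tendsto (fun ε : ℝ => ENNReal.ofReal ε *
        (K * (ENNReal.ofReal (δ⁻¹ ^ (m + 2)) * ∫⁻ y, ENNReal.ofReal (h y)))) (𝓝[>] 0) (𝓝 0) := by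
      have h1 : Tendsto (fun ε : ℝ => ENNReal.ofReal ε) (𝓝[>] 0) (𝓝 0) := by
        have := (ENNReal.continuous_ofReal.tendsto 0).mono_left
          (nhdsWithin_le_nhds (s := Set.Ioi (0 : ℝ)))
        simpa using this
      have := ENNReal.Tendsto.mul_const h1 (Or.inr hconst)
      simpa using this
    refine tendsto_of_tendsto_of_tendsto_of_le_of_le' tendsto_const_nhds hlim
      (Eventually.of_forall fun _ => zero_le) ?_
    filter_upwards [self_mem_nhdsWithin] with ε hε
    have hε' : (0 : ℝ) < ε := hε
    refine (mul_le_mul_right (lintegral_inv_mul_comp_div_le hν hm h0 hδ' hε') _).trans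
      (le_of_eq ?_)
    have h2 : ENNReal.ofReal (ε ^ (m + 1) * δ⁻¹ ^ (m + 2)) =
        ENNReal.ofReal (ε ^ m) * (ENNReal.ofReal ε * ENNReal.ofReal (δ⁻¹ ^ (m + 2))) := by
      rw [← ENNReal.ofReal_mul hε'.le, ← ENNReal.ofReal_mul (by positivity)]
      congr 1
      ring
    have h3 : ENNReal.ofReal (ε ^ m)⁻¹ * ENNReal.ofReal (ε ^ m) = 1 := by
      rw [← ENNReal.ofReal_mul (by positivity), inv_mul_cancel₀ (by positivity),
        ENNReal.ofReal_one]
    rw [h2]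
    calc _ = (ENNReal.ofReal (ε ^ m)⁻¹ * ENNReal.ofReal (ε ^ m)) * (ENNReal.ofReal ε *
        (K * (ENNReal.ofReal (δ⁻¹ ^ (m + 2)) * ∫⁻ y, ENNReal.ofReal (h y)))) := by ring
      _ = _ := by rw [h3, one_mul]
  have := hmain.add htail
  rw [add_zero] at this
  exact this.congr' hsplit

/-- The product of a variable of law `μ` with an independent one of law `ν`. The constant `d` gets
multiplied by the moment of order `-(m + 1)` of `ν`. -/
theorem HasPowerDensity.map_mul_prod {m : ℕ} {μ ν : Measure ℝ} [IsFiniteMeasure μ]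
    [IsProbabilityMeasure ν] (hμ : HasPowerDensity m μ) {K : ENNReal} (hK : K ≠ ⊤)
    (hν : ν ≤ powerMeasure K (m + 1)) :
    HasPowerDensity m ((ν.prod μ).map fun q => q.1 * q.2) := by
  obtain ⟨d, hd, h, hm, h0, hdens, hh⟩ := hμ
  have hpos := ae_pos_of_le_powerMeasure hν
  have hint : ∫⁻ y, ENNReal.ofReal (h y) ≠ ⊤ := by
    have h1 := measure_ne_top μ Set.univ
    rwa [hdens, withDensity_apply _ MeasurableSet.univ, Measure.restrict_univ] at h1
  set H : ℝ → ENNReal := fun ε => ∫⁻ w, ENNReal.ofReal (w⁻¹ * h (ε / w)) ∂ν with hH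
  have hHm : Measurable H := by
    have : Measurable fun q : ℝ × ℝ => ENNReal.ofReal (q.2⁻¹ * h (q.1 / q.2)) := by fun_prop
    exact this.lintegral_prod_right'
  have hlaw : (ν.prod μ).map (fun q => q.1 * q.2) = volume.withDensity H := by
    refine Measure.ext_of_lintegral _ fun f hf => ?_
    rw [lintegral_map hf (by fun_prop), lintegral_prod _ (by fun_prop),
      lintegral_withDensity_eq_lintegral_mul _ hHm hf]
    have h1 : ∀ᵐ w ∂ν, ∫⁻ y, f (w * y) ∂μ =
        ∫⁻ ε, ENNReal.ofReal (w⁻¹ * h (ε / w)) * f ε := by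
      filter_upwards [hpos] with w hw
      rw [hdens, lintegral_withDensity_eq_lintegral_mul _ (by fun_prop) (by fun_prop)]
      exact lintegral_mul_comp_mul hm hf hw
    rw [lintegral_congr_ae h1, lintegral_lintegral_swap (by fun_prop)]
    refine lintegral_congr fun ε => ?_
    rw [lintegral_mul_const _ (by fun_prop)]
    rfl
  have hfin : ∀ᵐ ε, H ε < ⊤ := by
    refine ae_lt_top hHm ?_
    have h1 := measure_ne_top ((ν.prod μ).map fun q => q.1 * q.2) Set.univ
    rwa [hlaw, withDensity_apply _ MeasurableSet.univ, Measure.restrict_univ] at h1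
  set I := ∫⁻ w, ENNReal.ofReal (d * w⁻¹ ^ (m + 1)) ∂ν with hI
  have hItop : I ≠ ⊤ := by
    simp_rw [hI, ENNReal.ofReal_mul hd.le]
    rw [lintegral_const_mul _ (by fun_prop)]
    exact ENNReal.mul_ne_top ENNReal.ofReal_ne_top (lintegral_inv_pow_ne_top hK hν)
  have hI0 : I ≠ 0 := by
    intro hzero
    rw [hI, lintegral_eq_zero_iff (by fun_prop)] at hzero
    have hfalse : ∀ᵐ _ ∂ν, False := by
      filter_upwards [hzero, hpos] with w h1 hw
      simp only [Pi.zero_apply, ENNReal.ofReal_eq_zero] at h1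
      exact absurd h1 (not_le.2 (by positivity))
    exact IsProbabilityMeasure.ne_zero ν (by simpa using hfalse)
  refine ⟨I.toReal, ENNReal.toReal_pos hI0 hItop, fun ε => (H ε).toReal, by fun_prop,
    fun _ => ENNReal.toReal_nonneg, ?_, ?_⟩
  · rw [hlaw]
    refine withDensity_congr_ae ?_
    filter_upwards [hfin] with ε hε
    rw [ENNReal.ofReal_toReal hε.ne]
  · refine isEquivalent_of_tendsto_div_pow (ENNReal.toReal_pos hI0 hItop) ?_
    have h1 := (ENNReal.tendsto_toReal hItop).comp
      (tendsto_lintegral_inv_mul_comp_div hK hν hm h0 hint hd hh)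
    refine h1.congr' ?_
    filter_upwards [self_mem_nhdsWithin] with ε hε
    have hε' : (0 : ℝ) < ε := hε
    rw [Function.comp_apply, ENNReal.toReal_mul, ENNReal.toReal_ofReal (by positivity)]
    ring

/-! ### The law of the factor of one reflection -/

/-- The law of the factor contributed by a reflection whose sphere has complex dimension
`p + 1 + (b + 1)`, that is, with `b + 1` coordinates left outside the orthonormal family. -/
noncomputable def factorLaw (p b : ℕ) : Measure ℝ :=
  ((ballWeight (p + 1) b Set.univ)⁻¹ • ballWeight (p + 1) b).map
    fun y => reflectionFactor (EuclideanSpace.single 0 1 - y)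

theorem measurable_reflectionFactor {p : ℕ} :
    Measurable (reflectionFactor : EuclideanSpace ℂ (Fin (p + 1)) → ℝ) := by
  unfold reflectionFactor
  fun_prop

theorem ballWeight_le_volume (a b : ℕ) : ballWeight a b ≤ volume := by
  refine le_trans ?_ (Measure.restrict_le_self (s := Metric.ball 0 1))
  conv_rhs => rw [← withDensity_one (μ := volume.restrict (Metric.ball 0 1))]
  refine withDensity_mono ?_
  filter_upwards [ae_restrict_mem Metric.isOpen_ball.measurableSet] with y hy
  rw [Pi.one_apply, ENNReal.ofReal_le_one]
  have : ‖y‖ < 1 := by simpa using hy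
  exact pow_le_one₀ (by nlinarith [norm_nonneg y]) (by nlinarith [norm_nonneg y])

theorem ballWeight_univ_ne_top (a b : ℕ) : ballWeight a b Set.univ ≠ ⊤ := by
  have h1 : ballWeight a b Set.univ ≤ volume (Metric.ball (0 : EuclideanSpace ℂ (Fin a)) 1) := by
    have hs : ballWeight a b (Metric.ball 0 1)ᶜ = 0 := by
      refine withDensity_absolutelyContinuous _ _ ?_
      rw [Measure.restrict_apply Metric.isOpen_ball.measurableSet.compl]
      simp
    rw [← Set.union_compl_self (Metric.ball 0 1)]
    refine (measure_union_le _ _).trans ?_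
    rw [hs, add_zero]
    exact ballWeight_le_volume a b _
  exact ne_top_of_le_ne_top measure_ball_lt_top.ne h1

theorem ballWeight_univ_ne_zero (a b : ℕ) : ballWeight a b Set.univ ≠ 0 := by
  rw [ballWeight, withDensity_apply _ MeasurableSet.univ, Measure.restrict_univ]
  intro h
  rw [lintegral_eq_zero_iff (by fun_prop)] at h
  have hfalse : ∀ᵐ _ ∂(volume.restrict (Metric.ball (0 : EuclideanSpace ℂ (Fin a)) 1)), False := by
    filter_upwards [h, ae_restrict_mem Metric.isOpen_ball.measurableSet] with y h1 hy
    have : ‖y‖ < 1 := by simpa using hy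
    have h2 : 0 < 1 - ‖y‖ ^ 2 := by nlinarith [norm_nonneg y]
    simp only [Pi.zero_apply, ENNReal.ofReal_eq_zero] at h1
    exact absurd h1 (not_le.2 (by positivity))
  rw [Filter.eventually_false_iff_eq_bot, ae_eq_bot, Measure.restrict_eq_zero] at hfalse
  exact (Metric.measure_ball_pos volume _ one_pos).ne' hfalse

instance isProbabilityMeasure_factorLaw (p b : ℕ) : IsProbabilityMeasure (factorLaw p b) := by
  have : IsProbabilityMeasure ((ballWeight (p + 1) b Set.univ)⁻¹ • ballWeight (p + 1) b) := by
    refine ⟨?_⟩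
    rw [Measure.smul_apply, smul_eq_mul]
    exact ENNReal.inv_mul_cancel (ballWeight_univ_ne_zero _ _) (ballWeight_univ_ne_top _ _)
  exact Measure.isProbabilityMeasure_map
    (measurable_reflectionFactor.comp (by fun_prop)).aemeasurable

/-- The factor is homogeneous of degree one on a space of real dimension `2 * p + 2`. -/
theorem exists_map_reflectionFactor_volume (p : ℕ) :
    ∃ K : ENNReal, K ≠ ⊤ ∧
      (volume : Measure (EuclideanSpace ℂ (Fin (p + 1)))).map reflectionFactor =
        powerMeasure K (2 * p + 1) := by
  set c := volume {y : EuclideanSpace ℂ (Fin (p + 1)) | reflectionFactor y < 1} with hc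
  let π : EuclideanSpace ℂ (Fin (p + 1)) →ₗ[ℝ] ℂ :=
    (EuclideanSpace.proj (0 : Fin (p + 1)) :
      EuclideanSpace ℂ (Fin (p + 1)) →L[ℂ] ℂ).toLinearMap.restrictScalars ℝ
  have hctop : c ≠ ⊤ := by
    -- Off the null set `y 0 = 0` the factor is at least `‖y‖`, since `‖y 0‖ ≤ ‖y‖`.
    have hsub : {y : EuclideanSpace ℂ (Fin (p + 1)) | reflectionFactor y < 1} ⊆
        Metric.ball 0 1 ∪ (LinearMap.ker π : Set _) := by
      intro y hy
      by_cases h0 : y 0 = 0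
      · exact Or.inr h0
      · left
        have hy' : ‖y‖ ^ 2 / ‖y 0‖ < 1 := hy
        have h1 : 0 < ‖y 0‖ := norm_pos_iff.2 h0
        rw [div_lt_one h1] at hy'
        have h2 : ‖y 0‖ ≤ ‖y‖ := PiLp.norm_apply_le y 0
        rw [mem_ball_zero_iff]
        nlinarith [norm_nonneg y]
    have hker : volume (LinearMap.ker π : Set (EuclideanSpace ℂ (Fin (p + 1)))) = 0 := by
      refine Measure.addHaar_submodule _ _ fun htop => ?_
      have : EuclideanSpace.single (0 : Fin (p + 1)) (1 : ℂ) ∈ LinearMap.ker π := by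
        rw [htop]; trivial
      simp [π] at this
    refine ne_top_of_le_ne_top ?_ ((measure_mono hsub).trans (measure_union_le _ _))
    rw [hker, add_zero]
    exact measure_ball_lt_top.ne
  have hhom : ∀ (t : ℝ) (y : EuclideanSpace ℂ (Fin (p + 1))), 0 < t →
      reflectionFactor (t • y) = t * reflectionFactor y := by
    intro t y ht
    simp only [reflectionFactor, PiLp.smul_apply, norm_smul, Real.norm_of_nonneg ht.le]
    rw [mul_pow, sq t, mul_assoc, mul_div_mul_left _ _ ht.ne', mul_div_assoc]
  have hlt : ∀ t : ℝ, 0 < t →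
      volume {y : EuclideanSpace ℂ (Fin (p + 1)) | reflectionFactor y < t} =
        c * ENNReal.ofReal (t ^ (2 * p + 1 + 1)) := by
    intro t ht
    rw [measure_lt_of_homogeneous volume hhom ht, finrank_real_euclideanSpace, Fintype.card_fin]
    rfl
  refine ⟨c * (2 * p + 1 + 1 : ℕ), ENNReal.mul_ne_top hctop (ENNReal.natCast_ne_top _), ?_⟩
  rw [map_eq_withDensity_of_measure_lt volume measurable_reflectionFactor
    (fun y => by unfold reflectionFactor; positivity) hctop hlt]
  rfl

theorem exists_factorLaw_le_powerMeasure (p b : ℕ) :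
    ∃ K : ENNReal, K ≠ ⊤ ∧ factorLaw p b ≤ powerMeasure K (2 * p + 1) := by
  obtain ⟨K, hK, hmap⟩ := exists_map_reflectionFactor_volume p
  refine ⟨(ballWeight (p + 1) b Set.univ)⁻¹ * K,
    ENNReal.mul_ne_top (ENNReal.inv_ne_top.2 (ballWeight_univ_ne_zero _ _)) hK, ?_⟩
  have h1 : (ballWeight (p + 1) b).map
      (fun y => reflectionFactor (EuclideanSpace.single 0 1 - y)) ≤
      powerMeasure K (2 * p + 1) := by
    have hm : Measurable fun y : EuclideanSpace ℂ (Fin (p + 1)) =>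
      EuclideanSpace.single 0 1 - y := by fun_prop
    refine (Measure.map_mono (ballWeight_le_volume _ _)
      (measurable_reflectionFactor.comp hm)).trans (le_of_eq ?_)
    rw [← hmap, ← Measure.map_map measurable_reflectionFactor hm]
    rw [(Measure.measurePreserving_sub_left volume (EuclideanSpace.single 0 1 :
      EuclideanSpace ℂ (Fin (p + 1)))).map_eq]
  rw [factorLaw, Measure.map_smul]
  calc _ ≤ (ballWeight (p + 1) b Set.univ)⁻¹ • powerMeasure K (2 * p + 1) := by gcongr
    _ = _ := by rw [powerMeasure, powerMeasure, smul_smul]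

theorem map_reflectionFactor_uniformTailSphere {n p b : ℕ} (k : Fin n)
    (h : n - k = p + 1 + (b + 1)) (q : Fin (p + 1) → EuclideanSpace ℂ {j : Fin n // k ≤ j})
    (hq : Orthonormal ℂ q) :
    (uniformTailSphere n k).map (fun x => reflectionFactor (EuclideanSpace.single 0 1 -
      WithLp.toLp 2 fun i => inner ℂ (q i) x.1)) = factorLaw p b := by
  rw [factorLaw, ← map_coord_uniformTailSphere k h q hq, Measure.map_map]
  · rfl
  · exact measurable_reflectionFactor.comp (by fun_prop)
  · refine Continuous.measurable ?_
    fun_prop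

/-! ### Measurability -/

theorem continuous_tailVector {n : ℕ} (k : Fin n) :
    Continuous (tailVector : TailSphere n k → Fin n → ℂ) := by
  refine continuous_pi fun j => ?_
  by_cases h : k ≤ j
  · simp only [tailVector, dif_pos h]
    fun_prop
  · simp only [tailVector, dif_neg h]
    fun_prop

theorem continuous_reflectionRoot {n : ℕ} (k : Fin n) :
    Continuous (reflectionRoot : TailSphere n k → Fin n → ℂ) :=
  (continuous_tailVector k).sub continuous_const

theorem measurable_rootStatistic {l n : ℕ} (k : Fin l → Fin n) : Measurable (rootStatistic k) := by
  unfold rootStatistic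
  refine Measurable.mul (Finset.measurable_prod _ fun i _ => ?_) ?_
  · have h1 : Continuous fun x : ∀ i, TailSphere n (k i) => tailVector (x i) (k i) :=
      (continuous_apply (k i)).comp ((continuous_tailVector (k i)).comp (continuous_apply i))
    exact (by fun_prop : Measurable fun z : ℂ => ‖1 / (1 - star z)‖).comp h1.measurable
  · refine Continuous.measurable (Continuous.norm (Continuous.matrix_det ?_))
    have h2 : ∀ i, Continuous fun x : ∀ i, TailSphere n (k i) => reflectionRoot (x i) :=
      fun i => (continuous_reflectionRoot (k i)).comp (continuous_apply i)
    refine continuous_matrix fun i j => ?_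
    exact Continuous.dotProduct (h2 i).star (h2 j)

theorem measurable_reflection {n : ℕ} (k : Fin n) :
    Measurable (reflection k : TailSphere n k → Matrix.unitaryGroup (Fin n) ℂ) := by
  let e : TailSphere n k := ⟨tailBasisVector k, by simp [tailBasisVector]⟩
  -- The coefficient `1 / (1 - conj (v k))` is discontinuous only at `v = e_k`.
  refine measurable_of_continuousOn_compl_singleton e ?_
  rw [continuousOn_iff_continuous_domRestrict]
  refine Continuous.subtype_mk ?_ _
  have hv : Continuous fun x : ({e}ᶜ : Set (TailSphere n k)) => tailVector x.1 :=
    (continuous_tailVector k).comp continuous_subtype_val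
  have hne : ∀ x : ({e}ᶜ : Set (TailSphere n k)), 1 - star (tailVector x.1 k) ≠ 0 := by
    intro x h0
    refine x.2 (Subtype.ext ?_)
    have h1 : tailVector x.1 k = 1 := by
      rw [sub_eq_zero, eq_comm, star_eq_iff_star_eq] at h0
      simpa using h0.symm
    rw [tailVector_self, ← inner_tailBasisVector,
      inner_eq_one_iff_of_norm_eq_one (by simp [tailBasisVector]) (by simp)] at h1
    exact h1.symm
  have hvk : Continuous fun x : ({e}ᶜ : Set (TailSphere n k)) => tailVector x.1 k :=
    (continuous_apply k).comp hv
  have hr : Continuous fun x : ({e}ᶜ : Set (TailSphere n k)) =>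
      tailVector x.1 - (Pi.single k 1 : Fin n → ℂ) := hv.sub continuous_const
  change Continuous fun x : ({e}ᶜ : Set (TailSphere n k)) => reflectionMatrix k (tailVector x.1)
  unfold reflectionMatrix
  exact continuous_const.sub ((continuous_const.div (continuous_const.sub hvk.star) hne).smul
    (hr.matrix_vecMulVec hr.star))

instance secondCountableTopology_unitaryGroup (n : ℕ) :
    SecondCountableTopology (Matrix.unitaryGroup (Fin n) ℂ) :=
  have : SecondCountableTopology (Matrix (Fin n) (Fin n) ℂ) :=
    inferInstanceAs (SecondCountableTopology (Fin n → Fin n → ℂ))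
  TopologicalSpace.Subtype.secondCountableTopology _

theorem measurable_list_ofFn_prod (n m : ℕ) :
    Measurable fun r : Fin m → Matrix.unitaryGroup (Fin n) ℂ => (List.ofFn r).prod := by
  refine Continuous.measurable ?_
  simp_rw [List.ofFn_eq_map]
  exact continuous_list_prod _ fun i _ => continuous_apply i

theorem continuous_charpolyDeriv {n : ℕ} (p : ℕ) :
    Continuous (charpolyDeriv p : Matrix.unitaryGroup (Fin n) ℂ → ℂ) := by
  -- The derivative is `p!` times a coefficient of the characteristic polynomial of `u - 1`,
  -- hence a polynomial in the entries of `u`.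
  have h : ∀ u : Matrix.unitaryGroup (Fin n) ℂ, charpolyDeriv p u = p.factorial *
      MvPolynomial.eval (fun ij : Fin n × Fin n =>
        ((u : Matrix (Fin n) (Fin n) ℂ) - Matrix.scalar (Fin n) (1 : ℂ) : Matrix _ _ ℂ) ij.1 ij.2)
        ((Matrix.charpoly.univ ℂ (Fin n)).coeff p) := by
    intro u
    have h1 := Matrix.charpoly.univ_coeff_eval₂Hom (Fin n) (RingHom.id ℂ)
      (fun ij : Fin n × Fin n =>
        ((u : Matrix (Fin n) (Fin n) ℂ) - Matrix.scalar (Fin n) (1 : ℂ) : Matrix _ _ ℂ) ij.1 ij.2) p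
    rw [charpolyDeriv, ← Polynomial.factorial_smul_hasseDeriv, LinearMap.smul_apply, nsmul_eq_mul,
      Polynomial.eval_mul, Polynomial.eval_natCast, ← Polynomial.taylor_coeff,
      Polynomial.taylor_apply, ← Matrix.charpoly_sub_scalar]
    congr 1
    exact h1.symm
  rw [funext h]
  refine continuous_const.mul ((MvPolynomial.continuous_eval _).comp (continuous_pi fun ij => ?_))
  have h2 : Continuous fun u : Matrix.unitaryGroup (Fin n) ℂ =>
      (u : Matrix (Fin n) (Fin n) ℂ) - Matrix.scalar (Fin n) (1 : ℂ) :=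
    continuous_subtype_val.sub continuous_const
  exact h2.matrix_elem ij.1 ij.2

/-! ### Induction on the number of reflections -/

/-- The indices `k i` are the last `l + 1` ones before `n - p`. Removing the first reflection
multiplies the statistic by an independent factor of law `factorLaw p l`. -/
theorem hasPowerDensity_map_rootStatistic {n p : ℕ} (l : ℕ) (k : Fin (l + 1) → Fin n)
    (hk : ∀ i, (k i : ℕ) + (l + 1 + p) = n + i) :
    HasPowerDensity (2 * p)
      ((Measure.pi fun i => uniformTailSphere n (k i)).map (rootStatistic k)) := by
  induction l with
  | zero =>
    have h0 : n - k 0 = p + 1 := by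
      have := hk 0
      simp only [Fin.val_zero] at this
      omega
    have := hasPowerDensity_map_ratio (k 0) h0
    rw [← (measurePreserving_eval (fun i => uniformTailSphere n (k i)) 0).map_eq,
      Measure.map_map] at this
    · convert this using 2
      funext x
      exact rootStatistic_fin_one k x
    · have hc : Measurable fun x : TailSphere n (k 0) =>
          inner ℂ (tailBasisVector (k 0)) x.1 := by
        refine Continuous.measurable ?_
        fun_prop
      exact (by fun_prop : Measurable fun c : ℂ => (2 - 2 * c.re) / ‖1 - c‖).comp hc
    · exact measurable_pi_apply 0
  | succ l ih =>
    set k' : Fin (l + 1) → Fin n := fun i => k ((0 : Fin (l + 2)).succAbove i) with hk'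
    have hrest := ih k' fun i => by
      have := hk i.succ
      simp only [hk', Fin.succAbove_zero, Fin.val_succ] at this ⊢
      omega
    have h0 := hk 0
    simp only [Fin.val_zero] at h0
    have hlt : ∀ i, k 0 < k ((0 : Fin (l + 2)).succAbove i) := fun i => by
      have := hk i.succ
      simp only [Fin.val_succ] at this
      rw [Fin.succAbove_zero, Fin.lt_def]
      omega
    obtain ⟨K, hK, hle⟩ := exists_factorLaw_le_powerMeasure p l
    have hst' : Measurable (rootStatistic k') := measurable_rootStatistic k'
    have : IsProbabilityMeasure
        ((Measure.pi fun i => uniformTailSphere n (k' i)).map (rootStatistic k')) :=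
      Measure.isProbabilityMeasure_map hst'.aemeasurable
    convert hrest.map_mul_prod hK hle using 1
    refine Measure.ext_of_lintegral _ fun f hf => ?_
    have hmp := (measurePreserving_piFinSuccAbove (fun i => uniformTailSphere n (k i)) 0).symm
    have hst := measurable_rootStatistic k
    rw [lintegral_map hf hst, ← hmp.map_eq,
      lintegral_map (f := fun x => f (rootStatistic k x)) (hf.comp hst) hmp.measurable,
      lintegral_prod_symm (fun z => f (rootStatistic k
        ((MeasurableEquiv.piFinSuccAbove (fun i => TailSphere n (k i)) 0).symm z))) ((hf.comp hst).comp hmp.measurable).aemeasurable,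
      lintegral_map hf (by fun_prop), lintegral_prod_symm _ (by fun_prop),
      lintegral_map (Measurable.lintegral_prod_left' (f := fun q : ℝ × ℝ => f (q.1 * q.2))
        (by fun_prop)) hst']
    refine lintegral_congr fun y => ?_
    obtain ⟨q, hq, heq⟩ := exists_rootStatistic_eq_mul (p := p) k hlt (by omega) y
    have hz : Continuous fun x : TailSphere n (k 0) => (EuclideanSpace.single 0 1 -
        WithLp.toLp 2 fun i => inner ℂ (q i) x.1 : EuclideanSpace ℂ (Fin (p + 1))) := by
      fun_prop
    rw [← map_reflectionFactor_uniformTailSphere (k 0) (by omega) q hq,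
      lintegral_map (g := fun x : TailSphere n (k 0) => reflectionFactor (EuclideanSpace.single 0 1 -
        WithLp.toLp 2 fun i => inner ℂ (q i) x.1)) (by fun_prop)
        (measurable_reflectionFactor.comp hz.measurable)]
    refine lintegral_congr fun x₀ => ?_
    have he := (MeasurableEquiv.piFinSuccAbove (fun i => TailSphere n (k i)) 0).apply_symm_apply
      (x₀, y)
    have hx := heq ((MeasurableEquiv.piFinSuccAbove (fun i => TailSphere n (k i)) 0).symm (x₀, y))
      (congrArg Prod.snd he)
    have hx0 : (MeasurableEquiv.piFinSuccAbove (fun i => TailSphere n (k i)) 0).symm (x₀, y) 0 =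
        x₀ := congrArg Prod.fst he
    rw [hx0] at hx
    rw [hx]

theorem map_norm_charpolyDeriv_conditionalHaar {n p : ℕ} (hp : p < n) :
    (conditionalHaar n p).map (fun u => ‖charpolyDeriv p u‖) =
      ((Measure.pi fun i : Fin (n - p) => uniformTailSphere n (i.castLE (Nat.sub_le n p))).map
        (rootStatistic fun i => i.castLE (Nat.sub_le n p))).map fun y => (p.factorial : ℝ) * y := by
  have hprob : ∀ i : Fin (n - p), IsProbabilityMeasure
      ((uniformTailSphere n (i.castLE (Nat.sub_le n p))).map
        (reflection (i.castLE (Nat.sub_le n p)))) := fun i =>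
    Measure.isProbabilityMeasure_map (measurable_reflection _).aemeasurable
  have hpi := Measure.pi_map_pi (μ := fun i : Fin (n - p) =>
    uniformTailSphere n (i.castLE (Nat.sub_le n p)))
    (f := fun i => reflection (i.castLE (Nat.sub_le n p)))
    fun i => (measurable_reflection _).aemeasurable
  have hr : Measurable fun (x : ∀ i : Fin (n - p), TailSphere n (i.castLE (Nat.sub_le n p))) i =>
      reflection (i.castLE (Nat.sub_le n p)) (x i) :=
    measurable_pi_lambda _ fun i => (measurable_reflection _).comp (measurable_pi_apply i)
  unfold conditionalHaar reflectionLaw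
  rw [← hpi, Measure.map_map (measurable_list_ofFn_prod _ _) hr,
    Measure.map_map (continuous_charpolyDeriv p).norm.measurable
      ((measurable_list_ofFn_prod _ _).comp hr),
    Measure.map_map (by fun_prop) (measurable_rootStatistic _)]
  congr 1
  funext x
  exact norm_charpolyDeriv_prod_reflection (by omega) _ x

theorem corollary5p2 (n p : ℕ) (hp : p < n) :
    ∃ d : ℝ, 0 < d ∧ ∃ h : ℝ → ℝ, Measurable h ∧ (∀ x, 0 ≤ h x) ∧
      (conditionalHaar n p).map (fun u => ‖charpolyDeriv p u‖) =
        volume.withDensity (fun x => ENNReal.ofReal (h x)) ∧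
      Asymptotics.IsEquivalent (nhdsWithin 0 (Set.Ioi 0)) h (fun ε => d * ε ^ (2 * p)) := by
  have hstat : HasPowerDensity (2 * p)
      ((Measure.pi fun i : Fin (n - p) => uniformTailSphere n (i.castLE (Nat.sub_le n p))).map
        (rootStatistic fun i => i.castLE (Nat.sub_le n p))) := by
    have hgen : ∀ m, 0 < m → ∀ k : Fin m → Fin n, (∀ i, (k i : ℕ) + (m + p) = n + i) →
        HasPowerDensity (2 * p)
          ((Measure.pi fun i => uniformTailSphere n (k i)).map (rootStatistic k)) := by
      rintro (_ | l) hm k hk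
      · exact absurd hm (lt_irrefl 0)
      · exact hasPowerDensity_map_rootStatistic l k hk
    refine hgen _ (by omega) _ fun i => ?_
    simp only [Fin.val_castLE]
    omega
  have := hstat.map_const_mul (c := (p.factorial : ℝ)) (by positivity)
  rw [← map_norm_charpolyDeriv_conditionalHaar hp] at this
  exact this
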